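/- Let $d\ge 1$, $s\in(0,1)$, and let $m:\mathbb R^d\to\mathbb R$ be measurable and even with $0<\alpha_1\le m(z)\le\alpha_2<\infty$ for all $z$. Let $\Lambda=\{h\in\mathbb R^d\setminus\{0\}: h/|h|\in I\cup(-I)\}$ be a double cone with apex at the origin, where $I$ is a nonempty relatively open subset of the unit sphere, let $0<r\le\infty$, and put $$k_r(x,y)=\frac{m(x-y)}{|x-y|^{d+2s}}\,\chi_{\Lambda\cap B_r(0)}(x-y)\qquad(B_\infty(0)=\mathbb R^d).$$ For vector fields $u,v:\mathbb R^d\to\mathbb R^d$ put $\mathcal D(u)(x,y)=(u(x)-u(y))\cdot\frac{x-y}{|x-y|}$ and, $k_r$ being symmetric, $$\mathcal F(u,v)=\tfrac12\int_{\mathbb R^d}\int_{\mathbb R^d}k_r(x,y)\,\mathcal D(u)(x,y)\,\mathcal D(v)(x,y)\,dy\,dx .$$ For a bounded open set $\Omega\subset\mathbb R^d$ let $L^2_\Omega$ be the set of $f\in L^2(\mathbb R^d;\mathbb R^d)$ with $f=0$ a.e. on $\mathbb R^d\setminus\Omega$, and let $S_\Omega$ be the set of $v\in L^2_\Omega$ with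 $\mathcal D(v)\,k_r^{1/2}\in L^2(\mathbb R^d\times\mathbb R^d)$. For $f\in L^2_\Omega$, a weak solution of the problem $\mathbb L u=f$ in $\Omega$, $u=0$ on $\mathbb R^d\setminus\Omega$, is a field $u\in S_\Omega$ such that $\mathcal F(u,\varphi)=\int_{\mathbb R^d} f\cdot\varphi\,dx$ for all $\varphi\in S_\Omega$. Let $f\in L^2_\Omega$. Then there is a weak solution $u$, it is unique up to equality a.e., and $u\in H^{2s}_{loc}(\Omega;\mathbb R^d)$, that is, $u\in L^2(\Omega;\mathbb R^d)$ and $\eta u\in H^{2s}(\mathbb R^d;\mathbb R^d)$ for every $\eta\in C_c^\infty(\Omega)$. Moreover, for every $\eta\in C_c^\infty(\Omega)$ there is a constant $C>0$, which may depend on $d,s,m,\Lambda,r,\Omega$ and $\eta$ but not on $f$ or $u$, such that $$|\eta u|_{H^{2s}}\le C\,\|f\|_{L^2},\qquad\text{where } |w|_{H^{2s}}=\big\|\,|\xi|^{2s}\hat w\,\big\|_{L^2}.$$ -/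

import Mathlib

open MeasureTheory FourierTransform
open scoped ENNReal ContDiff

noncomputable section

/-- The Euclidean space `ℝᵈ`. -/
abbrev RSpace (d : ℕ) : Type := EuclideanSpace ℝ (Fin d)

/-- The Hermitian space `ℂᵈ`. -/
abbrev CSpace (d : ℕ) : Type := EuclideanSpace ℂ (Fin d)

/-! ### Nonlocal forms and weak solutions -/

/-- The nonlocal linearized strain `𝒟(u)(x, y) = (u(x) - u(y)) · (x - y) / |x - y|`. -/
def nonlocalStrain {d : ℕ} (u : RSpace d → RSpace d) (x y : RSpace d) : ℝ :=
  inner ℝ (u x - u y) (‖x - y‖⁻¹ • (x - y))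

/-- The symmetric part `k_s` of a kernel. -/
def symmPart {d : ℕ} (k : RSpace d → RSpace d → ℝ) (x y : RSpace d) : ℝ :=
  (k x y + k y x) / 2

/-- The antisymmetric part `k_a` of a kernel. -/
def antiPart {d : ℕ} (k : RSpace d → RSpace d → ℝ) (x y : RSpace d) : ℝ :=
  (k x y - k y x) / 2

/-- `f ∈ L²_Ω(ℝᵈ)`: a square integrable vector field on `ℝᵈ` which vanishes a.e. outside `Ω`. -/
def MemL2Vanishing {d : ℕ} (Ω : Set (RSpace d)) (f : RSpace d → RSpace d) : Prop :=
  MemLp f 2 volume ∧ ∀ᵐ x ∂(volume : Measure (RSpace d)), x ∉ Ω → f x = 0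

/-- `v ∈ S(ℝᵈ; k)`: `v ∈ L²(ℝᵈ; ℝᵈ)` and `𝒟(v) k_s^{1/2} ∈ L²(ℝᵈ × ℝᵈ)`. -/
def MemS {d : ℕ} (k : RSpace d → RSpace d → ℝ) (v : RSpace d → RSpace d) : Prop :=
  MemLp v 2 volume ∧
    MemLp (fun p : RSpace d × RSpace d =>
      nonlocalStrain v p.1 p.2 * Real.sqrt (symmPart k p.1 p.2)) 2 volume

/-- `v ∈ S_Ω(ℝᵈ; k)`: elements of `S(ℝᵈ; k)` which vanish a.e. outside `Ω`. -/
def MemSVanishing {d : ℕ} (k : RSpace d → RSpace d → ℝ) (Ω : Set (RSpace d))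
    (v : RSpace d → RSpace d) : Prop :=
  MemS k v ∧ ∀ᵐ x ∂(volume : Measure (RSpace d)), x ∉ Ω → v x = 0

/-- The bilinear form
`ℱᵏ(u, v) = ½ ∬ k_s 𝒟(u) 𝒟(v) + ∬ k_a(x, y) 𝒟(u)(x, y) (v(x) · (x - y)/|x - y|)`. -/
def nonlocalForm {d : ℕ} (k : RSpace d → RSpace d → ℝ) (u v : RSpace d → RSpace d) : ℝ :=
  (1 / 2) * (∫ p : RSpace d × RSpace d,
      symmPart k p.1 p.2 * nonlocalStrain u p.1 p.2 * nonlocalStrain v p.1 p.2) +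
    ∫ p : RSpace d × RSpace d,
      antiPart k p.1 p.2 * nonlocalStrain u p.1 p.2 *
        inner ℝ (v p.1) (‖p.1 - p.2‖⁻¹ • (p.1 - p.2))

/-- `u` is a weak solution of `𝕃 u = f` in `Ω`, `u = 0` on the complement of `Ω`. -/
def IsWeakSolution {d : ℕ} (k : RSpace d → RSpace d → ℝ) (Ω : Set (RSpace d))
    (f u : RSpace d → RSpace d) : Prop :=
  MemSVanishing k Ω u ∧
    ∀ φ : RSpace d → RSpace d, MemSVanishing k Ω φ →
      nonlocalForm k u φ = ∫ x, inner ℝ (f x) (φ x)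

/-! ### Kernels supported on double cones -/

/-- The double cone of all nonzero `h` whose direction `h / |h|` lies in `I ∪ (-I)`. -/
def doubleCone {d : ℕ} (I : Set (Metric.sphere (0 : RSpace d) 1)) : Set (RSpace d) :=
  {h | h ≠ 0 ∧ ∃ e ∈ I, ‖h‖⁻¹ • h = (e : RSpace d) ∨ ‖h‖⁻¹ • h = -(e : RSpace d)}

/-- `Λ` is a double cone with apex at the origin, spanned by a nonempty (relatively) open set of
directions. -/
def IsDoubleCone {d : ℕ} (Λ : Set (RSpace d)) : Prop :=
  ∃ I : Set (Metric.sphere (0 : RSpace d) 1), IsOpen I ∧ I.Nonempty ∧ Λ = doubleCone I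

/-- The kernel `k_r(x, y) = m(x - y) |x - y|^{-d-2s} χ_{Λ ∩ B_r(0)}(x - y)`, with `0 < r ≤ ∞`;
`B_∞(0)` is the whole space. -/
def coneKernel {d : ℕ} (s : ℝ) (m : RSpace d → ℝ) (Λ : Set (RSpace d)) (r : ℝ≥0∞)
    (x y : RSpace d) : ℝ :=
  (Λ ∩ Metric.eball 0 r).indicator (fun z => m z / ‖z‖ ^ ((d : ℝ) + 2 * s)) (x - y)

/-! ### Fractional Sobolev spaces -/

/-- The inclusion `ℝᵈ → ℂᵈ`. -/
def toComplexVec {d : ℕ} (v : RSpace d) : CSpace d :=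
  WithLp.toLp 2 fun i => (v i : ℂ)

theorem norm_toComplexVec {d : ℕ} (v : RSpace d) : ‖toComplexVec v‖ = ‖v‖ := by
  simp [toComplexVec, EuclideanSpace.norm_eq]

theorem continuous_toComplexVec {d : ℕ} : Continuous (toComplexVec (d := d)) := by
  unfold toComplexVec
  fun_prop

theorem memLp_toComplexVec {d : ℕ} {u : RSpace d → RSpace d} (hu : MemLp u 2 volume) :
    MemLp (fun x => toComplexVec (u x)) 2 volume :=
  hu.of_le (continuous_toComplexVec.comp_aestronglyMeasurable hu.1)
    (Filter.Eventually.of_forall fun x => (norm_toComplexVec (u x)).le)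

/-- A square integrable vector field `ℝᵈ → ℝᵈ` as a class of `L²(ℝᵈ; ℂᵈ)`. -/
def complexL2 {d : ℕ} (u : RSpace d → RSpace d) (hu : MemLp u 2 volume) :
    Lp (CSpace d) 2 (volume : Measure (RSpace d)) :=
  (memLp_toComplexVec hu).toLp

/-- `u ∈ H^σ(ℝᵈ; ℝᵈ)`, for `σ ≥ 0`. -/
def MemHs {d : ℕ} (σ : ℝ) (u : RSpace d → RSpace d) : Prop :=
  ∃ hu : MemLp u 2 volume,
    TemperedDistribution.MemSobolev σ 2
      (Lp.toTemperedDistribution (complexL2 u hu))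

open Classical in
/-- The seminorm `|u|_{H^σ} = ‖ |ξ|^σ û ‖_{L²}`, as an element of `[0, ∞]` (it is `∞` if `u` is not
square integrable). -/
def hsSeminorm {d : ℕ} (σ : ℝ) (u : RSpace d → RSpace d) : ℝ≥0∞ :=
  if hu : MemLp u 2 volume then
    eLpNorm (fun ξ : RSpace d =>
      (‖ξ‖ ^ σ) • ((𝓕 (complexL2 u hu) : Lp (CSpace d) 2 (volume : Measure (RSpace d))) ξ))
      2 volume
  else ∞

/-- `η ∈ C_c^∞(Ω)`, real valued. -/
def IsCutoff {d : ℕ} (Ω : Set (RSpace d)) (η : RSpace d → ℝ) : Prop :=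
  ContDiff ℝ ∞ η ∧ HasCompactSupport η ∧ tsupport η ⊆ Ω

/-- `u ∈ H^σ_loc(Ω; ℝᵈ)`: `u ∈ L²(Ω; ℝᵈ)` and `η u ∈ H^σ(ℝᵈ; ℝᵈ)` for all `η ∈ C_c^∞(Ω)`. -/
def MemHsLoc {d : ℕ} (σ : ℝ) (Ω : Set (RSpace d)) (u : RSpace d → RSpace d) : Prop :=
  MemLp u 2 (volume.restrict Ω) ∧
    ∀ η : RSpace d → ℝ, IsCutoff Ω η → MemHs σ fun x => η x • u x

end

/-! Write K for the profile of the kernel and D_h v(x) = (v(x+h) - v(x)) · h/|h|. Shearing (x, y) to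
(h + y, y) turns the form into F(u, v) = ½ ∫ K(h) ⟨D_h u, D_h v⟩ dh. Only two features of K matter:
it is even, nonnegative and integrates min(1, |h|)² (`IsLevyDensity`), and some ball B in the cone
satisfies K(t/l) ≥ α l^(d+2s) for t ∈ B, l ≥ 1 (`IsConeElliptic`). An open set of directions sees
every component of a vector: ∫_B (w·t)² (a·t)² dt ≥ c |w|² |a|²
(`exists_le_setIntegral_inner_sq_mul_inner_sq`).

Existence and uniqueness. For t ∈ B, finitely many steps of length t leave Ω, so telescoping bounds
the component of u along t by D_t u; integrating over B gives the Poincaré inequality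
(`exists_lpNorm_sq_le_integral_energyDensity`). Hence a field in S_Ω depends continuously on its
weighted strain, the strains form a closed subspace of L², and Riesz representation there yields the
solution.

Regularity. Put w = ηu. For every φ of finite energy, F(w, φ) differs from F(u, ηφ) = ∫ f · ηφ by a
commutator bounded by the L² norm and energy of u times the L² norm of φ alone
(`HasIncrBound.abs_nonlocalForm_smul_sub_le`); so F(w, φ) ≤ A ‖f‖ ‖φ‖. On the Fourier side the form
has a matrix symbol bounded below by a multiple of |ξ|^(2s) for |ξ| ≥ 1
(`exists_le_lintegral_symbol`). Testing with the φ whose transform is g ŵ, where g = |ξ|^(2s) cut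
off at |ξ| < R, makes F(w, φ) control ∫ g |ξ|^(2s) |ŵ|² = ∫ |g ŵ|² over |ξ| ≥ 1
(`exists_test_field`). With X = ‖g ŵ‖ ≥ ‖φ‖ this reads X² ≤ ‖w‖² + c A ‖f‖ X, so X is bounded
independently of R, and Fatou's lemma removes the cutoff. The full 2s derivatives appear because φ
enters the upper bound only through its L² norm. -/

noncomputable section

variable {d : ℕ} {K : RSpace d → ℝ}

/-! ### Auxiliary facts on square integrable functions -/

section SquareIntegrable

variable {α : Type*} [MeasurableSpace α] {μ : Measure α}

theorem lpNorm_two_sq {F : Type*} [NormedAddCommGroup F] {f : α → F} (hf : MemLp f 2 μ) :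
    lpNorm f 2 μ ^ 2 = ∫ x, ‖f x‖ ^ 2 ∂μ := by
  rw [lpNorm_eq_integral_norm_rpow_toReal (by simp) (by simp) hf.1]
  have h0 : 0 ≤ ∫ x, ‖f x‖ ^ 2 ∂μ := integral_nonneg fun x => by positivity
  simp only [ENNReal.toReal_ofNat, Real.rpow_ofNat]
  rw [← Real.rpow_natCast, ← Real.rpow_mul h0]
  simp

theorem norm_integral_inner_le_lpNorm {𝕜 F : Type*} [RCLike 𝕜] [NormedAddCommGroup F]
    [InnerProductSpace 𝕜 F] {f g : α → F} (hf : MemLp f 2 μ) (hg : MemLp g 2 μ) :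
    ‖∫ x, inner 𝕜 (f x) (g x) ∂μ‖ ≤ lpNorm f 2 μ * lpNorm g 2 μ := by
  have h := norm_inner_le_norm (𝕜 := 𝕜) (hf.toLp f) (hg.toLp g)
  rw [L2.inner_def, Lp.norm_toLp, Lp.norm_toLp, toReal_eLpNorm hf.1, toReal_eLpNorm hg.1] at h
  refine le_of_eq_of_le (congrArg _ (integral_congr_ae ?_)) h
  filter_upwards [hf.coeFn_toLp, hg.coeFn_toLp] with x h1 h2
  rw [h1, h2]

theorem abs_integral_mul_le_lpNorm {f g : α → ℝ} (hf : MemLp f 2 μ) (hg : MemLp g 2 μ) :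
    |∫ x, f x * g x ∂μ| ≤ lpNorm f 2 μ * lpNorm g 2 μ := by
  have h := norm_integral_inner_le_lpNorm (𝕜 := ℝ) hf hg
  simpa [mul_comm] using h

theorem lpNorm_le_mul_lpNorm {F G : Type*} [NormedAddCommGroup F] [NormedAddCommGroup G]
    {f : α → F} {g : α → G} {c : ℝ} (hc : 0 ≤ c) (hf : AEStronglyMeasurable f μ)
    (hg : MemLp g 2 μ) (h : ∀ᵐ x ∂μ, ‖f x‖ ≤ c * ‖g x‖) :
    lpNorm f 2 μ ≤ c * lpNorm g 2 μ := by
  have h1 := eLpNorm_le_mul_eLpNorm_of_ae_le_mul h 2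
  rw [← toReal_eLpNorm hf, ← toReal_eLpNorm hg.1, ← ENNReal.toReal_ofReal hc,
    ← ENNReal.toReal_mul]
  exact ENNReal.toReal_mono (ENNReal.mul_ne_top (by simp) hg.2.ne) h1

end SquareIntegrable

/-! ### Directional increments and the energy of a translation invariant kernel -/

/-- The increment of `v` over `h`, in direction `h / |h|`. -/
def strainIncr (h : RSpace d) (v : RSpace d → RSpace d) (x : RSpace d) : ℝ :=
  inner ℝ (v (x + h) - v x) (‖h‖⁻¹ • h)

theorem nonlocalStrain_add_left (v : RSpace d → RSpace d) (h y : RSpace d) :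
    nonlocalStrain v (h + y) y = strainIncr h v y := by
  simp [nonlocalStrain, strainIncr, add_comm]

theorem norm_inv_smul_self_le (h : RSpace d) : ‖‖h‖⁻¹ • h‖ ≤ 1 := by
  rw [norm_smul, norm_inv, norm_norm]
  exact inv_mul_le_one

theorem measurePreserving_add_const (h : RSpace d) :
    MeasurePreserving (fun x : RSpace d => x + h) volume volume :=
  measurePreserving_add_right volume h

theorem memLp_shift {F : Type*} [NormedAddCommGroup F] {f : RSpace d → F} (hf : MemLp f 2 volume)
    (h : RSpace d) : MemLp (fun x => f (x + h)) 2 volume :=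
  hf.comp_measurePreserving (measurePreserving_add_const h)

theorem lpNorm_shift {F : Type*} [NormedAddCommGroup F] {f : RSpace d → F}
    (hf : MemLp f 2 volume) (h : RSpace d) :
    lpNorm (fun x => f (x + h)) 2 volume = lpNorm f 2 volume := by
  rw [← toReal_eLpNorm (memLp_shift hf h).1, ← toReal_eLpNorm hf.1]
  congr 1
  exact eLpNorm_comp_measurePreserving hf.1 (measurePreserving_add_const h)

theorem memLp_strainIncr {v : RSpace d → RSpace d} (hv : MemLp v 2 volume) (h : RSpace d) :
    MemLp (strainIncr h v) 2 volume :=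
  ((memLp_shift hv h).sub hv).inner_const _

theorem strainIncr_eq (h : RSpace d) (v : RSpace d → RSpace d) (x : RSpace d) :
    strainIncr h v x =
      inner ℝ (v (x + h)) (‖h‖⁻¹ • h) - inner ℝ (v x) (‖h‖⁻¹ • h) := by
  simp only [strainIncr, inner_sub_left]

theorem measurePreserving_shear :
    MeasurePreserving (fun p : RSpace d × RSpace d => (p.1 + p.2, p.2)) volume volume :=
  measurePreserving_add_prod volume volume

theorem aestronglyMeasurable_nonlocalStrain {v : RSpace d → RSpace d}
    (hv : AEStronglyMeasurable v volume) :
    AEStronglyMeasurable (fun p : RSpace d × RSpace d => nonlocalStrain v p.1 p.2) volume := by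
  have h1 : AEStronglyMeasurable (fun p : RSpace d × RSpace d => v p.1) volume := hv.comp_fst
  have h2 : AEStronglyMeasurable (fun p : RSpace d × RSpace d => v p.2) volume := hv.comp_snd
  refine (h1.sub h2).inner (Measurable.aestronglyMeasurable ?_)
  fun_prop

theorem aestronglyMeasurable_strainIncr {v : RSpace d → RSpace d}
    (hv : AEStronglyMeasurable v volume) :
    AEStronglyMeasurable (fun p : RSpace d × RSpace d => strainIncr p.1 v p.2) volume := by
  have := (aestronglyMeasurable_nonlocalStrain hv).comp_measurePreserving measurePreserving_shear
  refine this.congr (Filter.Eventually.of_forall fun p => ?_)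
  exact nonlocalStrain_add_left v p.1 p.2

theorem symmPart_of_even {K : RSpace d → ℝ} (hK : ∀ h, K (-h) = K h) (x y : RSpace d) :
    symmPart (fun x y => K (x - y)) x y = K (x - y) := by
  have : K (y - x) = K (x - y) := by rw [← hK, neg_sub]
  simp [symmPart, this]

theorem antiPart_of_even {K : RSpace d → ℝ} (hK : ∀ h, K (-h) = K h) (x y : RSpace d) :
    antiPart (fun x y => K (x - y)) x y = 0 := by
  have : K (y - x) = K (x - y) := by rw [← hK, neg_sub]
  simp [antiPart, this]

/-- The properties of a translation invariant kernel `K(x - y)` used throughout. -/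
structure IsLevyDensity (K : RSpace d → ℝ) : Prop where
  measurable : Measurable K
  nonneg : ∀ h, 0 ≤ K h
  even : ∀ h, K (-h) = K h
  integrable_min : Integrable (fun h => K h * min 1 ‖h‖ ^ 2) volume

/-- The energy density `h ↦ K(h) ‖D_h v‖²`. -/
def energyDensity (K : RSpace d → ℝ) (v : RSpace d → RSpace d) (h : RSpace d) : ℝ :=
  K h * lpNorm (strainIncr h v) 2 volume ^ 2

theorem lpNorm_strainIncr_sq {v : RSpace d → RSpace d} (hv : MemLp v 2 volume) (h : RSpace d) :
    lpNorm (strainIncr h v) 2 volume ^ 2 = ∫ y, strainIncr h v y ^ 2 := by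
  simp [lpNorm_two_sq (memLp_strainIncr hv h)]

/-- Tonelli after the shear (h, y) ↦ (h + y, y). Finite energy becomes a condition in the single
variable h, which can be checked by pointwise bounds on the increments. -/
theorem memS_iff_integrable_energyDensity (hK : IsLevyDensity K) {v : RSpace d → RSpace d}
    (hv : MemLp v 2 volume) :
    MemS (fun x y => K (x - y)) v ↔ Integrable (energyDensity K v) volume := by
  have hm : AEStronglyMeasurable (fun p : RSpace d × RSpace d =>
      nonlocalStrain v p.1 p.2 * Real.sqrt (symmPart (fun x y => K (x - y)) p.1 p.2)) volume := by
    refine (aestronglyMeasurable_nonlocalStrain hv.1).mul (Measurable.aestronglyMeasurable ?_)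
    simp only [symmPart_of_even hK.even]
    exact (hK.measurable.comp (measurable_fst.sub measurable_snd)).sqrt
  unfold MemS
  rw [and_iff_right hv, memLp_two_iff_integrable_sq hm,
    ← measurePreserving_shear.integrable_comp (by fun_prop)]
  have e1 : ((fun p : RSpace d × RSpace d => (nonlocalStrain v p.1 p.2 *
      Real.sqrt (symmPart (fun x y => K (x - y)) p.1 p.2)) ^ 2) ∘ fun p => (p.1 + p.2, p.2)) =
      fun p : RSpace d × RSpace d => K p.1 * strainIncr p.1 v p.2 ^ 2 := by
    funext p
    simp only [Function.comp, symmPart_of_even hK.even, nonlocalStrain_add_left, mul_pow,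
      Real.sq_sqrt (hK.nonneg _), add_sub_cancel_right]
    ring
  rw [e1]
  have hm2 : AEStronglyMeasurable
      (fun p : RSpace d × RSpace d => K p.1 * strainIncr p.1 v p.2 ^ 2) volume :=
    (hK.measurable.comp measurable_fst).aestronglyMeasurable.mul
      ((aestronglyMeasurable_strainIncr hv.1).pow 2)
  rw [Measure.volume_eq_prod, integrable_prod_iff (by exact hm2)]
  have h1 : ∀ᵐ h : RSpace d, Integrable (fun y => K h * strainIncr h v y ^ 2) volume :=
    Filter.Eventually.of_forall fun h => (memLp_strainIncr hv h).integrable_sq.const_mul _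
  rw [and_iff_right h1]
  refine integrable_congr (Filter.Eventually.of_forall fun h => ?_)
  simp only [energyDensity, lpNorm_strainIncr_sq hv, norm_mul, norm_pow, Real.norm_eq_abs, sq_abs,
    abs_of_nonneg (hK.nonneg _), integral_const_mul]

theorem MemS.integrable_energyDensity (hK : IsLevyDensity K) {v : RSpace d → RSpace d}
    (hv : MemS (fun x y => K (x - y)) v) : Integrable (energyDensity K v) volume :=
  (memS_iff_integrable_energyDensity hK hv.1).1 hv

/-- The form as an integral over the translations. -/
theorem nonlocalForm_eq_integral_strainIncr (hK : IsLevyDensity K) {u v : RSpace d → RSpace d}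
    (hu : MemS (fun x y => K (x - y)) u) (hv : MemS (fun x y => K (x - y)) v) :
    Integrable (fun h => K h * ∫ y, strainIncr h u y * strainIncr h v y) volume ∧
    nonlocalForm (fun x y => K (x - y)) u v =
      (1 / 2) * ∫ h, K h * ∫ y, strainIncr h u y * strainIncr h v y := by
  have hi : Integrable (fun p : RSpace d × RSpace d => symmPart (fun x y => K (x - y)) p.1 p.2 *
      nonlocalStrain u p.1 p.2 * nonlocalStrain v p.1 p.2) volume := by
    refine (hu.2.integrable_mul hv.2).congr (Filter.Eventually.of_forall fun p => ?_)
    simp only [Pi.mul_apply, symmPart_of_even hK.even]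
    have := Real.mul_self_sqrt (hK.nonneg (p.1 - p.2))
    linear_combination (nonlocalStrain u p.1 p.2 * nonlocalStrain v p.1 p.2) * this
  have e1 : ((fun p : RSpace d × RSpace d => symmPart (fun x y => K (x - y)) p.1 p.2 *
      nonlocalStrain u p.1 p.2 * nonlocalStrain v p.1 p.2) ∘ fun p => (p.1 + p.2, p.2)) =
      fun p : RSpace d × RSpace d => K p.1 * (strainIncr p.1 u p.2 * strainIncr p.1 v p.2) := by
    funext p
    simp only [Function.comp, symmPart_of_even hK.even, nonlocalStrain_add_left,
      add_sub_cancel_right]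
    ring
  have hi2 := (measurePreserving_shear.integrable_comp hi.1).2 hi
  rw [e1, Measure.volume_eq_prod] at hi2
  constructor
  · refine hi2.integral_prod_left.congr (Filter.Eventually.of_forall fun h => ?_)
    simp only [integral_const_mul]
  · have e2 : ∫ p : RSpace d × RSpace d, symmPart (fun x y => K (x - y)) p.1 p.2 *
        nonlocalStrain u p.1 p.2 * nonlocalStrain v p.1 p.2 =
        ∫ p : RSpace d × RSpace d, K p.1 * (strainIncr p.1 u p.2 * strainIncr p.1 v p.2) := by
      rw [← e1]
      have hi' := hi.1
      rw [← measurePreserving_shear.map_eq] at hi'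
      have := integral_map measurePreserving_shear.measurable.aemeasurable hi'
      rwa [measurePreserving_shear.map_eq] at this
    simp only [nonlocalForm, antiPart_of_even hK.even, zero_mul, integral_zero, add_zero]
    rw [e2, Measure.volume_eq_prod, integral_prod _ hi2]
    simp only [integral_const_mul]

theorem nonlocalForm_self_eq (hK : IsLevyDensity K) {u : RSpace d → RSpace d}
    (hu : MemS (fun x y => K (x - y)) u) :
    nonlocalForm (fun x y => K (x - y)) u u = (1 / 2) * ∫ h, energyDensity K u h := by
  rw [(nonlocalForm_eq_integral_strainIncr hK hu hu).2]
  congr 2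
  funext h
  rw [energyDensity, lpNorm_strainIncr_sq hu.1]
  simp only [sq]

/-! ### The cone kernel -/

theorem isOpen_doubleCone {I : Set (Metric.sphere (0 : RSpace d) 1)} (hI : IsOpen I) :
    IsOpen (doubleCone I) := by
  obtain ⟨U, hU, rfl⟩ := isOpen_induced_iff.1 hI
  -- Off the origin, where normalization is continuous, the cone is the preimage of the open set U ∪
  -- -U of directions.
  have hE : doubleCone ((↑) ⁻¹' U : Set (Metric.sphere (0 : RSpace d) 1)) =
      {0}ᶜ ∩ (fun h : RSpace d => ‖h‖⁻¹ • h) ⁻¹' (U ∪ -U) := by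
    ext h
    simp only [doubleCone, Set.mem_ofPred_eq, Set.mem_inter_iff, Set.mem_compl_iff,
      Set.mem_singleton_iff, Set.mem_preimage, Set.mem_union, Set.mem_neg, Subtype.exists,
      exists_and_left]
    refine and_congr_right fun hh => ?_
    have hs : ‖h‖⁻¹ • h ∈ Metric.sphere (0 : RSpace d) 1 := by
      simp [norm_smul, inv_mul_cancel₀ (norm_ne_zero_iff.2 hh)]
    have hs' : -(‖h‖⁻¹ • h) ∈ Metric.sphere (0 : RSpace d) 1 := by simpa using hs
    constructor
    · rintro ⟨e, heU, -, he | he⟩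
      · left; rwa [he]
      · right; rwa [he, neg_neg]
    · rintro (hm | hm)
      · exact ⟨_, hm, hs, Or.inl rfl⟩
      · exact ⟨_, hm, hs', Or.inr (neg_neg _).symm⟩
  rw [hE]
  refine ContinuousOn.isOpen_inter_preimage ?_ isOpen_compl_singleton (hU.union hU.neg)
  intro x hx
  have hx' : ‖x‖ ≠ 0 := norm_ne_zero_iff.2 hx
  exact (((continuous_norm (E := RSpace d)).continuousAt.inv₀ hx').smul
    continuousAt_id).continuousWithinAt

theorem smul_mem_doubleCone {I : Set (Metric.sphere (0 : RSpace d) 1)} {h : RSpace d}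
    (hh : h ∈ doubleCone I) {c : ℝ} (hc : 0 < c) : c • h ∈ doubleCone I := by
  obtain ⟨h0, e, heI, he⟩ := hh
  refine ⟨smul_ne_zero hc.ne' h0, e, heI, ?_⟩
  have : ‖c • h‖⁻¹ • c • h = ‖h‖⁻¹ • h := by
    rw [norm_smul, Real.norm_of_nonneg hc.le, smul_smul]
    congr 1
    field_simp
  rwa [this]

theorem neg_mem_doubleCone {I : Set (Metric.sphere (0 : RSpace d) 1)} {h : RSpace d}
    (hh : h ∈ doubleCone I) : -h ∈ doubleCone I := by
  obtain ⟨h0, e, heI, he⟩ := hh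
  refine ⟨neg_ne_zero.2 h0, e, heI, ?_⟩
  rw [norm_neg, smul_neg, neg_inj]
  rcases he with he | he
  · exact Or.inr (by rw [he])
  · exact Or.inl (by rw [he, neg_neg])

/-- The bound 1/2 keeps |t·ξ|/|ξ| ≤ 1/2, the range in which the symbol of an increment is comparable
to its linear part. -/
theorem exists_closedBall_subset_doubleCone {I : Set (Metric.sphere (0 : RSpace d) 1)}
    (hI : IsOpen I) (hne : I.Nonempty) {r : ℝ≥0∞} (hr : 0 < r) :
    ∃ (t₀ : RSpace d) (δ : ℝ), 0 < δ ∧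
      ∀ t ∈ Metric.closedBall t₀ δ, t ∈ doubleCone I ∩ Metric.eball 0 r ∧ ‖t‖ ≤ 1 / 2 := by
  have hO : IsOpen (doubleCone I ∩ Metric.eball 0 r ∩ Metric.ball 0 (1 / 2)) :=
    ((isOpen_doubleCone hI).inter Metric.isOpen_eball).inter Metric.isOpen_ball
  obtain ⟨e, he⟩ := hne
  have hen : ‖(e : RSpace d)‖ = 1 := by simp
  have heC : (e : RSpace d) ∈ doubleCone I :=
    ⟨norm_ne_zero_iff.1 (by rw [hen]; exact one_ne_zero), e, he, Or.inl (by simp [hen])⟩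
  obtain ⟨ρ, hρ0, hρr⟩ := ENNReal.lt_iff_exists_nnreal_btwn.1 hr
  have hρ : (0 : ℝ) < ρ := by exact_mod_cast hρ0
  set c : ℝ := min ρ (1 / 4) with hc
  have hc0 : 0 < c := lt_min hρ (by norm_num)
  have hcn : ‖c • (e : RSpace d)‖ = c := by
    rw [norm_smul, hen, mul_one, Real.norm_of_nonneg hc0.le]
  have hmem : c • (e : RSpace d) ∈ doubleCone I ∩ Metric.eball 0 r ∩ Metric.ball 0 (1 / 2) := by
    refine ⟨⟨smul_mem_doubleCone heC hc0, ?_⟩, ?_⟩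
    · rw [Metric.mem_eball, edist_zero_right, ← ofReal_norm, hcn]
      refine lt_of_le_of_lt ?_ hρr
      rw [← ENNReal.ofReal_coe_nnreal]
      exact ENNReal.ofReal_le_ofReal (min_le_left _ _)
    · rw [mem_ball_zero_iff, hcn]
      exact lt_of_le_of_lt (min_le_right _ _) (by norm_num)
  obtain ⟨δ, hδ, hsub⟩ := Metric.nhds_basis_closedBall.mem_iff.1 (hO.mem_nhds hmem)
  refine ⟨_, δ, hδ, fun t ht => ⟨(hsub ht).1, ?_⟩⟩
  have := (hsub ht).2
  rw [mem_ball_zero_iff] at this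
  exact this.le

theorem ae_inner_ne_zero {w : RSpace d} (hw : w ≠ 0) :
    ∀ᵐ t ∂(volume : Measure (RSpace d)), inner ℝ w t ≠ (0 : ℝ) := by
  have h := Measure.addHaar_submodule (volume : Measure (RSpace d))
    (LinearMap.ker (innerSL ℝ w).toLinearMap) ?_
  · rw [ae_iff]
    convert h using 2
    ext t
    simp
  · intro hT
    have : w ∈ LinearMap.ker (innerSL ℝ w).toLinearMap := by rw [hT]; trivial
    simp at this
    exact hw this

/-- The integrand vanishes only on two hyperplanes, which are null sets, so the integral is positive
for unit vectors w and a. Compactness of the product of spheres makes this uniform, and homogeneity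
of degree two in each argument gives the general case. -/
theorem exists_le_setIntegral_inner_sq_mul_inner_sq (t₀ : RSpace d) {δ : ℝ} (hδ : 0 < δ) :
    ∃ c : ℝ, 0 < c ∧ ∀ w a : RSpace d, c * (‖w‖ ^ 2 * ‖a‖ ^ 2) ≤
      ∫ t in Metric.closedBall t₀ δ, inner ℝ w t ^ 2 * inner ℝ a t ^ 2 := by
  set B := Metric.closedBall t₀ δ with hB
  have hBc : IsCompact B := isCompact_closedBall _ _
  set S : Set (RSpace d × RSpace d) := Metric.sphere 0 1 ×ˢ Metric.sphere 0 1 with hS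
  have hSc : IsCompact S := (isCompact_sphere _ _).prod (isCompact_sphere _ _)
  set Q : RSpace d × RSpace d → ℝ := fun q => ∫ t in B, inner ℝ q.1 t ^ 2 * inner ℝ q.2 t ^ 2
    with hQ
  have hQc : Continuous Q := by
    apply continuous_parametric_integral_of_continuous _ hBc
    simp only [Function.uncurry_def]
    fun_prop
  have hQpos : ∀ q ∈ S, 0 < Q q := by
    rintro ⟨w, a⟩ ⟨hw, ha⟩
    have hw0 : w ≠ 0 := ne_zero_of_mem_unit_sphere (⟨w, hw⟩ : Metric.sphere (0 : RSpace d) 1)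
    have ha0 : a ≠ 0 := ne_zero_of_mem_unit_sphere (⟨a, ha⟩ : Metric.sphere (0 : RSpace d) 1)
    have hint : IntegrableOn (fun t => inner ℝ w t ^ 2 * inner ℝ a t ^ 2) B volume :=
      ContinuousOn.integrableOn_compact hBc (by fun_prop)
    rw [hQ, setIntegral_pos_iff_support_of_nonneg_ae
      (Filter.Eventually.of_forall fun t => by positivity) hint]
    refine lt_of_lt_of_le (Metric.measure_closedBall_pos volume t₀ hδ) (measure_mono_ae ?_)
    filter_upwards [ae_inner_ne_zero hw0, ae_inner_ne_zero ha0] with t h1 h2 ht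
    refine ⟨?_, ht⟩
    simp only [Function.mem_support]
    positivity
  have hhom : ∀ (w a : RSpace d) (x y : ℝ), Q (x • w, y • a) = x ^ 2 * y ^ 2 * Q (w, a) := by
    intro w a x y
    simp only [hQ, real_inner_smul_left, ← integral_const_mul]
    congr 1
    funext t
    ring
  obtain ⟨c, hc0, hc⟩ : ∃ c : ℝ, 0 < c ∧ ∀ q ∈ S, c ≤ Q q := by
    -- The spheres are empty only in dimension zero, where any constant will do.
    by_cases hne : S.Nonempty
    · obtain ⟨q, hq, hmin⟩ := hSc.exists_isMinOn hne hQc.continuousOn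
      exact ⟨Q q, hQpos q hq, fun q' hq' => hmin hq'⟩
    · exact ⟨1, one_pos, fun q hq => absurd ⟨q, hq⟩ hne⟩
  refine ⟨c, hc0, fun w a => ?_⟩
  change _ ≤ Q (w, a)
  by_cases hw : w = 0
  · rw [hw]
    simp [hQ]
  by_cases ha : a = 0
  · rw [ha]
    simp [hQ]
  have hmem : (‖w‖⁻¹ • w, ‖a‖⁻¹ • a) ∈ S := by
    constructor <;> simp [norm_smul, hw, ha]
  have h1 := hc _ hmem
  rw [hhom] at h1
  have hw' : 0 < ‖w‖ := norm_pos_iff.2 hw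
  have ha' : 0 < ‖a‖ := norm_pos_iff.2 ha
  calc c * (‖w‖ ^ 2 * ‖a‖ ^ 2)
      ≤ (‖w‖⁻¹ ^ 2 * ‖a‖⁻¹ ^ 2 * Q (w, a)) * (‖w‖ ^ 2 * ‖a‖ ^ 2) := by gcongr
    _ = Q (w, a) := by field_simp

/-- The profile of the cone kernel. -/
def coneDensity (s : ℝ) (m : RSpace d → ℝ) (Λ : Set (RSpace d)) (r : ℝ≥0∞) : RSpace d → ℝ :=
  (Λ ∩ Metric.eball 0 r).indicator fun z => m z / ‖z‖ ^ ((d : ℝ) + 2 * s)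

theorem coneKernel_eq (s : ℝ) (m : RSpace d → ℝ) (Λ : Set (RSpace d)) (r : ℝ≥0∞) :
    coneKernel s m Λ r = fun x y => coneDensity s m Λ r (x - y) := rfl

/-- In polar coordinates the radial integrand is y^(1-2s) on (0, 1], integrable since s < 1, and
y^(-1-2s) beyond 1, integrable since s > 0. -/
theorem integrable_min_one_sq_div_rpow (hd : 0 < d) {s : ℝ} (hs0 : 0 < s) (hs1 : s < 1) :
    Integrable (fun z : RSpace d => min 1 ‖z‖ ^ 2 / ‖z‖ ^ ((d : ℝ) + 2 * s)) volume := by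
  have : Nonempty (Fin d) := ⟨⟨0, hd⟩⟩
  rw [integrable_fun_norm_addHaar volume
    (f := fun y : ℝ => min 1 y ^ 2 / y ^ ((d : ℝ) + 2 * s)),
    ← Set.Ioc_union_Ioi_eq_Ioi (zero_le_one' ℝ), finrank_euclideanSpace_fin]
  have hd1 : ((d - 1 : ℕ) : ℝ) = d - 1 := by
    rw [Nat.cast_sub hd, Nat.cast_one]
  refine IntegrableOn.union ?_ ?_
  · have h : IntegrableOn (fun y : ℝ => y ^ (1 - 2 * s)) (Set.Ioc 0 1) := by
      rw [← intervalIntegrable_iff_integrableOn_Ioc_of_le zero_le_one]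
      exact intervalIntegral.intervalIntegrable_rpow' (by linarith)
    refine h.congr_fun (fun y hy => ?_) measurableSet_Ioc
    simp only [smul_eq_mul, min_eq_right hy.2]
    rw [← Real.rpow_natCast, ← Real.rpow_natCast, ← Real.rpow_sub hy.1, ← Real.rpow_add hy.1, hd1]
    congr 1
    push_cast
    ring
  · have h : IntegrableOn (fun y : ℝ => y ^ (-1 - 2 * s)) (Set.Ioi 1) :=
      integrableOn_Ioi_rpow_of_lt (by linarith) one_pos
    refine h.congr_fun (fun y hy => ?_) measurableSet_Ioi
    have hy' : (1 : ℝ) < y := hy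
    have hy0 : 0 < y := one_pos.trans hy'
    simp only [smul_eq_mul, min_eq_left hy'.le, one_pow, one_div]
    rw [← Real.rpow_natCast, ← Real.rpow_neg hy0.le, ← Real.rpow_add hy0, hd1]
    congr 1
    ring

theorem isLevyDensity_coneDensity {s : ℝ} (hs0 : 0 < s) (hs1 : s < 1)
    {m : RSpace d → ℝ} (hm : Measurable m) (hm_even : ∀ z, m (-z) = m z)
    {α₁ α₂ : ℝ} (hα₁ : 0 < α₁) (hm_bdd : ∀ z, α₁ ≤ m z ∧ m z ≤ α₂)
    {I : Set (Metric.sphere (0 : RSpace d) 1)} (hI : IsOpen I) (hd : 0 < d) (r : ℝ≥0∞) :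
    IsLevyDensity (coneDensity s m (doubleCone I) r) := by
  have hmeas : Measurable (coneDensity s m (doubleCone I) r) := by
    refine Measurable.indicator ?_
      ((isOpen_doubleCone hI).measurableSet.inter Metric.isOpen_eball.measurableSet)
    exact hm.div (by fun_prop)
  have hnn : ∀ h, 0 ≤ coneDensity s m (doubleCone I) r h := fun h =>
    Set.indicator_nonneg (fun z _ => div_nonneg (hα₁.le.trans (hm_bdd z).1) (by positivity)) h
  refine ⟨hmeas, hnn, fun h => ?_, ?_⟩
  · have hiff : -h ∈ doubleCone I ∩ Metric.eball 0 r ↔ h ∈ doubleCone I ∩ Metric.eball 0 r := by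
      refine and_congr ⟨fun hh => by simpa using neg_mem_doubleCone hh, neg_mem_doubleCone⟩ ?_
      simp [Metric.mem_eball]
    by_cases hh : h ∈ doubleCone I ∩ Metric.eball 0 r
    · rw [coneDensity, Set.indicator_of_mem hh, Set.indicator_of_mem (hiff.2 hh), hm_even, norm_neg]
    · rw [coneDensity, Set.indicator_of_notMem hh, Set.indicator_of_notMem (hiff.not.2 hh)]
  · refine ((integrable_min_one_sq_div_rpow hd hs0 hs1).const_mul α₂).mono'
      (hmeas.mul (by fun_prop)).aestronglyMeasurable (Filter.Eventually.of_forall fun h => ?_)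
    rw [Real.norm_of_nonneg (mul_nonneg (hnn h) (by positivity))]
    have hα₂ : 0 ≤ α₂ := hα₁.le.trans ((hm_bdd 0).1.trans (hm_bdd 0).2)
    have h1 : coneDensity s m (doubleCone I) r h ≤ α₂ / ‖h‖ ^ ((d : ℝ) + 2 * s) := by
      refine Set.indicator_apply_le' (fun _ => ?_) (fun _ => by positivity)
      exact div_le_div_of_nonneg_right (hm_bdd h).2 (by positivity)
    calc coneDensity s m (doubleCone I) r h * min 1 ‖h‖ ^ 2
        ≤ α₂ / ‖h‖ ^ ((d : ℝ) + 2 * s) * min 1 ‖h‖ ^ 2 := by gcongr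
      _ = α₂ * (min 1 ‖h‖ ^ 2 / ‖h‖ ^ ((d : ℝ) + 2 * s)) := by ring

/-- `K` dominates a kernel of order `2s` on the cone spanned by the closed ball `B(t₀, δ)`, near the
origin. -/
structure IsConeElliptic (K : RSpace d → ℝ) (s : ℝ) (t₀ : RSpace d) (δ α : ℝ) : Prop where
  radius_pos : 0 < δ
  const_pos : 0 < α
  ne_zero : ∀ t ∈ Metric.closedBall t₀ δ, t ≠ 0
  norm_le : ∀ t ∈ Metric.closedBall t₀ δ, ‖t‖ ≤ 1 / 2
  lower : ∀ t ∈ Metric.closedBall t₀ δ, ∀ l : ℝ, 1 ≤ l → α * l ^ ((d : ℝ) + 2 * s) ≤ K (l⁻¹ • t)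

/-- Shrinking t by l⁻¹ ≤ 1 keeps it in the cone and in the ball of radius r, and |t| ≤ 1 means that
|t|^(-d-2s) can be dropped from the lower bound. -/
theorem exists_isConeElliptic_coneDensity {s : ℝ} (hs0 : 0 < s) {m : RSpace d → ℝ} {α₁ : ℝ}
    (hα₁ : 0 < α₁) (hm : ∀ z, α₁ ≤ m z) {I : Set (Metric.sphere (0 : RSpace d) 1)}
    (hI : IsOpen I) (hne : I.Nonempty) {r : ℝ≥0∞} (hr : 0 < r) :
    ∃ (t₀ : RSpace d) (δ : ℝ), IsConeElliptic (coneDensity s m (doubleCone I) r) s t₀ δ α₁ := by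
  obtain ⟨t₀, δ, hδ, h⟩ := exists_closedBall_subset_doubleCone hI hne hr
  refine ⟨t₀, δ, hδ, hα₁, fun t ht => (h t ht).1.1.1, fun t ht => (h t ht).2, ?_⟩
  intro t ht l hl
  obtain ⟨⟨htC, htr⟩, htn⟩ := h t ht
  have hl0 : 0 < l := one_pos.trans_le hl
  have ht0 : 0 < ‖t‖ := norm_pos_iff.2 htC.1
  have hnorm : ‖l⁻¹ • t‖ = l⁻¹ * ‖t‖ := by
    rw [norm_smul, Real.norm_of_nonneg (inv_nonneg.2 hl0.le)]
  have hmem : l⁻¹ • t ∈ doubleCone I ∩ Metric.eball 0 r := by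
    refine ⟨smul_mem_doubleCone htC (inv_pos.2 hl0), ?_⟩
    rw [Metric.mem_eball, edist_zero_right] at htr ⊢
    refine lt_of_le_of_lt ?_ htr
    rw [← ofReal_norm, ← ofReal_norm, hnorm]
    exact ENNReal.ofReal_le_ofReal (mul_le_of_le_one_left ht0.le (inv_le_one_of_one_le₀ hl))
  have hp : 0 ≤ (d : ℝ) + 2 * s := by positivity
  rw [coneDensity, Set.indicator_of_mem hmem, hnorm, Real.mul_rpow (by positivity) ht0.le,
    Real.inv_rpow hl0.le, le_div_iff₀ (by positivity)]
  have h1 : ‖t‖ ^ ((d : ℝ) + 2 * s) ≤ 1 := Real.rpow_le_one ht0.le (by linarith) hp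
  have h2 : 0 < l ^ ((d : ℝ) + 2 * s) := by positivity
  calc α₁ * l ^ ((d : ℝ) + 2 * s) * ((l ^ ((d : ℝ) + 2 * s))⁻¹ * ‖t‖ ^ ((d : ℝ) + 2 * s))
      = α₁ * ‖t‖ ^ ((d : ℝ) + 2 * s) := by field_simp
    _ ≤ α₁ * 1 := by gcongr
    _ ≤ m (l⁻¹ • t) := by rw [mul_one]; exact hm _

/-! ### The Poincaré inequality -/

theorem lpNorm_sub_shift_nsmul_le {g : RSpace d → ℝ} (hg : MemLp g 2 volume) (h : RSpace d)
    (N : ℕ) :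
    lpNorm (fun x => g (x + N • h) - g x) 2 volume ≤
      N * lpNorm (fun x => g (x + h) - g x) 2 volume := by
  induction N with
  | zero => simp
  | succ N ih =>
    have h1 : MemLp (fun x => g (x + h) - g x) 2 volume := (memLp_shift hg h).sub hg
    have h2 : MemLp (fun x => g (x + N • h) - g x) 2 volume := (memLp_shift hg _).sub hg
    have e : (fun x => g (x + (N + 1) • h) - g x) =
        (fun x => (fun x => g (x + h) - g x) (x + N • h)) + fun x => g (x + N • h) - g x := by
      funext x
      simp only [Pi.add_apply, add_smul, one_smul, add_assoc]
      ring
    rw [e]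
    refine (lpNorm_add_le (memLp_shift h1 _) (by norm_num)).trans ?_
    rw [lpNorm_shift h1]
    push_cast
    linarith

/-- On Ω the value at x + N h vanishes, so |g(x)| is exactly the size of the N-fold increment, which
telescopes into N single ones. -/
theorem lpNorm_le_mul_lpNorm_sub_shift {Ω : Set (RSpace d)} {g : RSpace d → ℝ}
    (hg : MemLp g 2 volume) (hg0 : ∀ᵐ x, x ∉ Ω → g x = 0) (h : RSpace d) (N : ℕ)
    (hN : ∀ x ∈ Ω, x + N • h ∉ Ω) :
    lpNorm g 2 volume ≤ N * lpNorm (fun x => g (x + h) - g x) 2 volume := by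
  have h2 : MemLp (fun x => g (x + N • h) - g x) 2 volume := (memLp_shift hg _).sub hg
  refine le_trans ?_ (lpNorm_sub_shift_nsmul_le hg h N)
  have h3 := lpNorm_le_mul_lpNorm (f := g) zero_le_one hg.1 h2 ?_
  · rwa [one_mul] at h3
  · have hs : ∀ᵐ x, x + N • h ∉ Ω → g (x + N • h) = 0 :=
      (measurePreserving_add_const (N • h)).quasiMeasurePreserving.ae hg0
    filter_upwards [hg0, hs] with x h0 h1
    by_cases hx : x ∈ Ω
    · rw [h1 (hN x hx)]
      simp
    · rw [h0 hx]
      simp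

theorem exists_lpNorm_sq_le_integral_energyDensity (hK : IsLevyDensity K) {s : ℝ} {t₀ : RSpace d}
    {δ α : ℝ} (hE : IsConeElliptic K s t₀ δ α) {Ω : Set (RSpace d)} (hΩ : Bornology.IsBounded Ω) :
    ∃ C : ℝ, 0 < C ∧ ∀ u : RSpace d → RSpace d, MemSVanishing (fun x y => K (x - y)) Ω u →
      lpNorm u 2 volume ^ 2 ≤ C * ∫ h, energyDensity K u h := by
  set B := Metric.closedBall t₀ δ with hB
  have hBc : IsCompact B := isCompact_closedBall _ _
  have hBm : MeasurableSet B := hBc.measurableSet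
  obtain ⟨c, hc0, hc⟩ := exists_le_setIntegral_inner_sq_mul_inner_sq t₀ hE.radius_pos
  obtain ⟨ρ, hρ0, hρ⟩ : ∃ ρ : ℝ, 0 < ρ ∧ ∀ t ∈ B, ρ ≤ ‖t‖ := by
    obtain ⟨t, ht, hmin⟩ := hBc.exists_isMinOn ⟨t₀, Metric.mem_closedBall_self hE.radius_pos.le⟩
      continuous_norm.continuousOn
    exact ⟨‖t‖, norm_pos_iff.2 (hE.ne_zero t ht), fun t' ht' => hmin ht'⟩
  -- N steps of length at least ρ exceed the diameter of Ω, so one N serves every direction in B.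
  obtain ⟨N, hN⟩ := exists_nat_gt (Metric.diam Ω / ρ)
  have hNpos : 0 < N := by
    have : (0 : ℝ) < N := lt_of_le_of_lt (div_nonneg Metric.diam_nonneg hρ0.le) hN
    exact_mod_cast this
  have hexit : ∀ t ∈ B, ∀ x ∈ Ω, x + N • t ∉ Ω := by
    intro t ht x hx hx'
    have h1 := Metric.dist_le_diam_of_mem hΩ hx' hx
    rw [dist_eq_norm, add_sub_cancel_left, ← Nat.cast_smul_eq_nsmul ℝ, norm_smul,
      Real.norm_of_nonneg (Nat.cast_nonneg N)] at h1
    rw [div_lt_iff₀ hρ0] at hN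
    have : (N : ℝ) * ρ ≤ N * ‖t‖ := by gcongr; exact hρ t ht
    linarith
  -- The factor N²/(4α) comes from telescoping with |t|² ≤ 1/4 and K(t) ≥ α (`hpt`); 4c is the lower
  -- bound of the averaged components (`hlow`).
  refine ⟨N ^ 2 / (4 * α) / (4 * c), by have := hE.const_pos; positivity, fun u hu => ?_⟩
  have hu2 := hu.1.1
  have hα := hE.const_pos
  have hen := hu.1.integrable_energyDensity hK
  have hnn : ∀ h, 0 ≤ energyDensity K u h := fun h => mul_nonneg (hK.nonneg h) (sq_nonneg _)
  have hpt : ∀ t ∈ B, ∫ y, inner ℝ (u y) t ^ 2 ≤ N ^ 2 / (4 * α) * energyDensity K u t := by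
    intro t ht
    have ht0 : 0 < ‖t‖ := norm_pos_iff.2 (hE.ne_zero t ht)
    have htn := hE.norm_le t ht
    have hg : MemLp (fun y => inner ℝ (u y) (‖t‖⁻¹ • t)) 2 volume := hu2.inner_const _
    have h1 := lpNorm_le_mul_lpNorm_sub_shift (Ω := Ω) hg
      (by filter_upwards [hu.2] with x hx hxΩ; rw [hx hxΩ, inner_zero_left]) t N (hexit t ht)
    have h2 : (fun x => inner ℝ (u (x + t)) (‖t‖⁻¹ • t) - inner ℝ (u x) (‖t‖⁻¹ • t)) =
        strainIncr t u := by
      funext x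
      rw [strainIncr_eq]
    rw [h2] at h1
    have h3 : ∫ y, inner ℝ (u y) t ^ 2 =
        ‖t‖ ^ 2 * lpNorm (fun y => inner ℝ (u y) (‖t‖⁻¹ • t)) 2 volume ^ 2 := by
      rw [lpNorm_two_sq hg, ← integral_const_mul]
      congr 1
      funext y
      rw [real_inner_smul_right, Real.norm_eq_abs, sq_abs]
      field_simp
    have h4 : α ≤ K t := by simpa using hE.lower t ht 1 le_rfl
    have h5 : ‖t‖ ^ 2 ≤ 1 / 4 := by nlinarith
    rw [h3, energyDensity]
    calc ‖t‖ ^ 2 * lpNorm (fun y => inner ℝ (u y) (‖t‖⁻¹ • t)) 2 volume ^ 2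
        ≤ 1 / 4 * (N * lpNorm (strainIncr t u) 2 volume) ^ 2 := by gcongr; exact lpNorm_nonneg
      _ = N ^ 2 / (4 * α) * (α * lpNorm (strainIncr t u) 2 volume ^ 2) := by field_simp
      _ ≤ _ := by gcongr
  have hBfin : IsFiniteMeasure (volume.restrict B) :=
    isFiniteMeasure_restrict.2 hBc.measure_lt_top.ne
  have hprod : Integrable (fun p : RSpace d × RSpace d => inner ℝ (u p.2) p.1 ^ 2)
      ((volume.restrict B).prod volume) := by
    have hb : Integrable (fun p : RSpace d × RSpace d => (1 : ℝ) * ‖u p.2‖ ^ 2)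
        ((volume.restrict B).prod volume) :=
      (integrable_const (1 : ℝ)).mul_prod ((memLp_two_iff_integrable_sq_norm hu2.1).1 hu2)
    refine hb.mono' ?_ ?_
    · exact (hu2.1.comp_snd.inner (measurable_fst.aestronglyMeasurable)).pow 2
    · have hmem : ∀ᵐ p ∂((volume.restrict B).prod (volume : Measure (RSpace d))), p.1 ∈ B :=
        Measure.quasiMeasurePreserving_fst.ae (ae_restrict_mem hBm)
      filter_upwards [hmem] with p hp
      rw [norm_pow, Real.norm_eq_abs, sq_abs, one_mul, ← sq_abs]
      have h1 := abs_real_inner_le_norm (u p.2) p.1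
      have h2 := hE.norm_le _ hp
      have h3 : ‖u p.2‖ * ‖p.1‖ ≤ ‖u p.2‖ :=
        mul_le_of_le_one_right (norm_nonneg _) (h2.trans (by norm_num))
      exact pow_le_pow_left₀ (abs_nonneg _) (h1.trans h3) 2
  -- Take w = a in the quartic bound and estimate one factor (a·t)² by |a|²/4 on B.
  have hlow : ∀ a : RSpace d, 4 * c * ‖a‖ ^ 2 ≤ ∫ t in B, inner ℝ a t ^ 2 := by
    intro a
    by_cases ha : a = 0
    · simp [ha]
    have ha' : 0 < ‖a‖ := norm_pos_iff.2 ha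
    have h1 := hc a a
    have h2 : ∫ t in B, inner ℝ a t ^ 2 * inner ℝ a t ^ 2 ≤
        ∫ t in B, (‖a‖ ^ 2 / 4) * inner ℝ a t ^ 2 := by
      refine setIntegral_mono_on (ContinuousOn.integrableOn_compact hBc (by fun_prop))
        (ContinuousOn.integrableOn_compact hBc (by fun_prop)) hBm fun t ht => ?_
      refine mul_le_mul_of_nonneg_right ?_ (sq_nonneg _)
      have h3 := abs_real_inner_le_norm a t
      have h4 : ‖a‖ * ‖t‖ ≤ ‖a‖ * (1 / 2) := by gcongr; exact hE.norm_le t ht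
      have h5 := pow_le_pow_left₀ (abs_nonneg _) (h3.trans h4) 2
      rw [sq_abs] at h5
      linarith
    rw [integral_const_mul] at h2
    have h3 : c * (‖a‖ ^ 2 * ‖a‖ ^ 2) ≤ ‖a‖ ^ 2 / 4 * ∫ t in B, inner ℝ a t ^ 2 := h1.trans h2
    have h4 : 0 < ‖a‖ ^ 2 / 4 := by positivity
    refine le_of_mul_le_mul_left (le_trans (le_of_eq ?_) h3) h4
    ring
  have hchain : 4 * c * lpNorm u 2 volume ^ 2 ≤
      N ^ 2 / (4 * α) * ∫ h, energyDensity K u h := by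
    calc 4 * c * lpNorm u 2 volume ^ 2 = ∫ y, 4 * c * ‖u y‖ ^ 2 := by
          rw [lpNorm_two_sq hu2, integral_const_mul]
      _ ≤ ∫ y, ∫ t in B, inner ℝ (u y) t ^ 2 :=
          integral_mono (((memLp_two_iff_integrable_sq_norm hu2.1).1 hu2).const_mul _)
            hprod.integral_prod_right fun y => hlow (u y)
      _ = ∫ t in B, ∫ y, inner ℝ (u y) t ^ 2 :=
          (integral_integral_swap (f := fun t y => inner ℝ (u y) t ^ 2) hprod).symm
      _ ≤ ∫ t in B, N ^ 2 / (4 * α) * energyDensity K u t :=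
          setIntegral_mono_on hprod.integral_prod_left (hen.const_mul _).integrableOn hBm hpt
      _ ≤ ∫ h, N ^ 2 / (4 * α) * energyDensity K u h :=
          setIntegral_le_integral (hen.const_mul _)
            (Filter.Eventually.of_forall fun h => mul_nonneg (by positivity) (hnn h))
      _ = _ := integral_const_mul _ _
  rw [div_mul_eq_mul_div, le_div_iff₀ (by positivity)]
  linarith

/-! ### Existence and uniqueness of weak solutions -/

/-- The weighted strain `𝒟(v) k_s^{1/2}`. -/
def weightedStrain (k : RSpace d → RSpace d → ℝ) (v : RSpace d → RSpace d)
    (p : RSpace d × RSpace d) : ℝ :=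
  nonlocalStrain v p.1 p.2 * Real.sqrt (symmPart k p.1 p.2)

theorem weightedStrain_add (k : RSpace d → RSpace d → ℝ) (u v : RSpace d → RSpace d) :
    weightedStrain k (u + v) = weightedStrain k u + weightedStrain k v := by
  funext p
  simp only [weightedStrain, nonlocalStrain, Pi.add_apply, inner_sub_left, inner_add_left]
  ring

theorem weightedStrain_smul (k : RSpace d → RSpace d → ℝ) (c : ℝ) (v : RSpace d → RSpace d) :
    weightedStrain k (c • v) = c • weightedStrain k v := by
  funext p
  simp only [weightedStrain, nonlocalStrain, Pi.smul_apply, inner_sub_left, real_inner_smul_left,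
    smul_eq_mul]
  ring

section

variable {k : RSpace d → RSpace d → ℝ} {Ω : Set (RSpace d)} {u v : RSpace d → RSpace d}

theorem MemSVanishing.memLp (hu : MemSVanishing k Ω u) : MemLp u 2 volume := hu.1.1

theorem MemSVanishing.memLp_weightedStrain (hu : MemSVanishing k Ω u) :
    MemLp (weightedStrain k u) 2 volume := hu.1.2

theorem MemSVanishing.add (hu : MemSVanishing k Ω u) (hv : MemSVanishing k Ω v) :
    MemSVanishing k Ω (u + v) := by
  refine ⟨⟨hu.memLp.add hv.memLp, ?_⟩, ?_⟩
  · change MemLp (weightedStrain k (u + v)) 2 volume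
    rw [weightedStrain_add]
    exact hu.memLp_weightedStrain.add hv.memLp_weightedStrain
  · filter_upwards [hu.2, hv.2] with x h1 h2 hx
    simp [h1 hx, h2 hx]

theorem MemSVanishing.const_smul (hu : MemSVanishing k Ω u) (c : ℝ) :
    MemSVanishing k Ω (c • u) := by
  refine ⟨⟨hu.memLp.const_smul c, ?_⟩, ?_⟩
  · change MemLp (weightedStrain k (c • u)) 2 volume
    rw [weightedStrain_smul]
    exact hu.memLp_weightedStrain.const_smul c
  · filter_upwards [hu.2] with x h1 hx
    simp [h1 hx]

theorem MemSVanishing.sub (hu : MemSVanishing k Ω u) (hv : MemSVanishing k Ω v) :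
    MemSVanishing k Ω (u - v) := by
  have := hu.add (hv.const_smul (-1))
  rwa [neg_one_smul, ← sub_eq_add_neg] at this

theorem weightedStrain_sub (k : RSpace d → RSpace d → ℝ) (u v : RSpace d → RSpace d) :
    weightedStrain k (u - v) = weightedStrain k u - weightedStrain k v := by
  have := weightedStrain_add k u ((-1 : ℝ) • v)
  rwa [weightedStrain_smul, neg_one_smul, neg_one_smul, ← sub_eq_add_neg,
    ← sub_eq_add_neg] at this

theorem memSVanishing_zero : MemSVanishing k Ω 0 := by
  refine ⟨⟨MemLp.zero, ?_⟩, by simp⟩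
  have : weightedStrain k (0 : RSpace d → RSpace d) = 0 := by
    simpa using weightedStrain_smul k 0 (0 : RSpace d → RSpace d)
  change MemLp (weightedStrain k 0) 2 volume
  rw [this]
  exact MemLp.zero

/-- The weighted strains of fields in `S_Ω`. -/
def strainRange (k : RSpace d → RSpace d → ℝ) (Ω : Set (RSpace d)) :
    Submodule ℝ (Lp ℝ 2 (volume : Measure (RSpace d × RSpace d))) where
  carrier := {w | ∃ v, MemSVanishing k Ω v ∧ w =ᵐ[volume] weightedStrain k v}
  zero_mem' := by
    refine ⟨0, memSVanishing_zero, ?_⟩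
    have : weightedStrain k (0 : RSpace d → RSpace d) = 0 := by
      simpa using weightedStrain_smul k 0 (0 : RSpace d → RSpace d)
    rw [this]
    exact Lp.coeFn_zero _ _ _
  add_mem' := by
    rintro w₁ w₂ ⟨v₁, h₁, e₁⟩ ⟨v₂, h₂, e₂⟩
    refine ⟨v₁ + v₂, h₁.add h₂, ?_⟩
    rw [weightedStrain_add]
    exact (Lp.coeFn_add w₁ w₂).trans (e₁.add e₂)
  smul_mem' := by
    rintro c w ⟨v, h, e⟩
    refine ⟨c • v, h.const_smul c, ?_⟩
    rw [weightedStrain_smul]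
    exact (Lp.coeFn_smul c w).trans (e.const_smul c)

/-- The Poincaré inequality on `S_Ω`. -/
def HasPoincare (k : RSpace d → RSpace d → ℝ) (Ω : Set (RSpace d)) (C : ℝ) : Prop :=
  0 ≤ C ∧ ∀ v, MemSVanishing k Ω v → lpNorm v 2 volume ≤ C * lpNorm (weightedStrain k v) 2 volume

theorem HasPoincare.ae_eq {C : ℝ} (hP : HasPoincare k Ω C) (hu : MemSVanishing k Ω u)
    (hv : MemSVanishing k Ω v) (h : weightedStrain k u =ᵐ[volume] weightedStrain k v) :
    u =ᵐ[volume] v := by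
  have h1 := hP.2 _ (hu.sub hv)
  have h2 : lpNorm (weightedStrain k (u - v)) 2 volume = 0 := by
    rw [lpNorm_eq_zero (hu.sub hv).memLp_weightedStrain (by norm_num), weightedStrain_sub]
    filter_upwards [h] with p hp
    simp [hp]
  rw [h2, mul_zero] at h1
  have h3 := (lpNorm_eq_zero (hu.sub hv).memLp (by norm_num)).1 (le_antisymm h1 lpNorm_nonneg)
  filter_upwards [h3] with x hx
  exact sub_eq_zero.1 hx

/-- By the Poincaré inequality a strain determines its field up to null sets, so a choice of
representatives is automatically linear in L² and bounded by C. -/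
theorem exists_fieldOfStrain {C : ℝ} (hP : HasPoincare k Ω C) :
    ∃ T : strainRange k Ω →L[ℝ] Lp (RSpace d) 2 (volume : Measure (RSpace d)),
      ∀ w, MemSVanishing k Ω (T w) ∧
        (w : Lp ℝ 2 (volume : Measure (RSpace d × RSpace d))) =ᵐ[volume]
          weightedStrain k (T w) := by
  have hex : ∀ w : strainRange k Ω, ∃ V : Lp (RSpace d) 2 (volume : Measure (RSpace d)),
      MemSVanishing k Ω V ∧ (w : Lp ℝ 2 (volume : Measure (RSpace d × RSpace d))) =ᵐ[volume]
        weightedStrain k V := by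
    rintro ⟨w, v, hv, hw⟩
    have e := hv.memLp.coeFn_toLp
    have e2 : weightedStrain k v =ᵐ[volume] weightedStrain k (hv.memLp.toLp v) := by
      have e3 := Measure.quasiMeasurePreserving_fst (μ := (volume : Measure (RSpace d)))
        (ν := (volume : Measure (RSpace d))) |>.ae e
      have e4 := Measure.quasiMeasurePreserving_snd (μ := (volume : Measure (RSpace d)))
        (ν := (volume : Measure (RSpace d))) |>.ae e
      rw [← Measure.volume_eq_prod] at e3 e4
      filter_upwards [e3, e4] with p h1 h2
      simp only [weightedStrain, nonlocalStrain, h1, h2]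
    refine ⟨hv.memLp.toLp v, ⟨⟨Lp.memLp _, ?_⟩, ?_⟩, hw.trans e2⟩
    · exact (memLp_congr_ae e2).1 hv.memLp_weightedStrain
    · filter_upwards [e, hv.2] with x h1 h2 hx
      rw [h1, h2 hx]
  choose T hT hTw using hex
  have hadd : ∀ w₁ w₂, T (w₁ + w₂) = T w₁ + T w₂ := by
    intro w₁ w₂
    refine Lp.ext (Filter.EventuallyEq.trans ?_ (Lp.coeFn_add _ _).symm)
    refine hP.ae_eq (hT _) ((hT w₁).add (hT w₂)) ?_
    rw [weightedStrain_add]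
    exact (hTw (w₁ + w₂)).symm.trans ((Lp.coeFn_add _ _).trans ((hTw w₁).add (hTw w₂)))
  have hsmul : ∀ (c : ℝ) w, T (c • w) = c • T w := by
    intro c w
    refine Lp.ext (Filter.EventuallyEq.trans ?_ (Lp.coeFn_smul _ _).symm)
    refine hP.ae_eq (hT _) ((hT w).const_smul c) ?_
    rw [weightedStrain_smul]
    exact (hTw (c • w)).symm.trans ((Lp.coeFn_smul _ _).trans ((hTw w).const_smul c))
  refine ⟨LinearMap.mkContinuous ⟨⟨T, hadd⟩, hsmul⟩ C fun w => ?_, fun w => ⟨hT w, hTw w⟩⟩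
  change ‖T w‖ ≤ C * ‖w‖
  have h1 := hP.2 _ (hT w)
  rw [← toReal_eLpNorm (hT w).memLp.1, ← toReal_eLpNorm (hT w).memLp_weightedStrain.1,
    ← eLpNorm_congr_ae (hTw w)] at h1
  exact h1

/-- If strains converge in L², so do their fields, by boundedness of the inverse map. The strain is
a pointwise expression, so a.e. convergence along a subsequence identifies the limit as the strain
of the limit field. -/
theorem isClosed_strainRange {C : ℝ} (hP : HasPoincare k Ω C) :
    IsClosed (strainRange k Ω : Set (Lp ℝ 2 (volume : Measure (RSpace d × RSpace d)))) := by
  obtain ⟨T, hT⟩ := exists_fieldOfStrain hP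
  refine IsSeqClosed.isClosed fun w w₀ hw hlim => ?_
  set w' : ℕ → strainRange k Ω := fun n => ⟨w n, hw n⟩ with hw'
  have hc : CauchySeq w' := by
    have := hlim.cauchySeq
    rw [Metric.cauchySeq_iff'] at this ⊢
    exact this
  obtain ⟨V, hV⟩ := cauchySeq_tendsto_of_complete (T.uniformContinuous.comp_cauchySeq hc)
  -- Two nested extractions: the first makes the fields converge a.e., the second the strains along
  -- it.
  obtain ⟨n₁, hn₁, hae₁⟩ := (tendstoInMeasure_of_tendsto_Lp hV).exists_seq_tendsto_ae
  obtain ⟨n₂, hn₂, hae₂⟩ := (tendstoInMeasure_of_tendsto_Lp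
    (hlim.comp hn₁.tendsto_atTop)).exists_seq_tendsto_ae
  have hstrain : w₀ =ᵐ[volume] weightedStrain k V := by
    have e3 := Measure.quasiMeasurePreserving_fst (μ := (volume : Measure (RSpace d)))
      (ν := (volume : Measure (RSpace d))) |>.ae hae₁
    have e4 := Measure.quasiMeasurePreserving_snd (μ := (volume : Measure (RSpace d)))
      (ν := (volume : Measure (RSpace d))) |>.ae hae₁
    rw [← Measure.volume_eq_prod] at e3 e4
    have e5 := ae_all_iff.2 fun n => (hT (w' n)).2
    filter_upwards [e3, e4, e5, hae₂] with p h1 h2 h3 h4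
    refine tendsto_nhds_unique h4 ?_
    have h5 : Filter.Tendsto (fun i => weightedStrain k (T (w' (n₁ (n₂ i)))) p) Filter.atTop
        (nhds (weightedStrain k V p)) := by
      have h1' := h1.comp hn₂.tendsto_atTop
      have h2' := h2.comp hn₂.tendsto_atTop
      exact ((h1'.sub h2').inner tendsto_const_nhds).mul_const _
    refine h5.congr fun i => ?_
    exact (h3 _).symm
  refine ⟨V, ⟨⟨Lp.memLp V, (memLp_congr_ae hstrain).1 (Lp.memLp w₀)⟩, ?_⟩, hstrain⟩
  have e5 := ae_all_iff.2 fun n => (hT (w' n)).1.2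
  filter_upwards [hae₁, e5] with x h1 h2 hx
  refine tendsto_nhds_unique h1 ?_
  refine tendsto_const_nhds.congr fun i => ?_
  exact (h2 (n₁ i) hx).symm

/-- The form is half the inner product of the weighted strains. -/
def FormEqStrain (k : RSpace d → RSpace d → ℝ) : Prop :=
  ∀ u v : RSpace d → RSpace d,
    nonlocalForm k u v = (1 / 2) * ∫ p, weightedStrain k u p * weightedStrain k v p

theorem exists_forall_inner_eq_of_continuousLinearMap {H G : Type*} [NormedAddCommGroup H]
    [InnerProductSpace ℝ H] [NormedAddCommGroup G] [InnerProductSpace ℝ G] (S : Submodule ℝ H)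
    [CompleteSpace S] (T : S →L[ℝ] G) (g : G) :
    ∃ w : S, ∀ w' : S, inner ℝ (w : H) (w' : H) = inner ℝ g (T w') :=
  ⟨(InnerProductSpace.toDual ℝ S).symm ((innerSL ℝ g).comp T), fun w' =>
    (Submodule.coe_inner S _ _).symm.trans (InnerProductSpace.toDual_symm_apply (x := w'))⟩

theorem exists_isWeakSolution {C : ℝ} (hP : HasPoincare k Ω C) (hF : FormEqStrain k)
    {f : RSpace d → RSpace d} (hf : MemLp f 2 volume) :
    ∃ u, IsWeakSolution k Ω f u := by
  obtain ⟨T, hT⟩ := exists_fieldOfStrain hP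
  have : CompleteSpace (strainRange k Ω) := (isClosed_strainRange hP).completeSpace_coe
  -- The factor 2 offsets the ½ in the form.
  obtain ⟨w, hw⟩ := exists_forall_inner_eq_of_continuousLinearMap (strainRange k Ω) T
    ((2 : ℝ) • hf.toLp f)
  refine ⟨T w, (hT _).1, fun φ hφ => ?_⟩
  have h1 := hw ⟨hφ.memLp_weightedStrain.toLp _, φ, hφ, hφ.memLp_weightedStrain.coeFn_toLp⟩
  have e := (hT ⟨hφ.memLp_weightedStrain.toLp _, φ, hφ, hφ.memLp_weightedStrain.coeFn_toLp⟩)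
  have e2 := hP.ae_eq e.1 hφ (e.2.symm.trans hφ.memLp_weightedStrain.coeFn_toLp)
  generalize T ⟨hφ.memLp_weightedStrain.toLp _, φ, hφ, hφ.memLp_weightedStrain.coeFn_toLp⟩ = V
    at h1 e2
  rw [real_inner_smul_left, L2.inner_def, L2.inner_def] at h1
  have h2 : ∫ x, inner ℝ (hf.toLp f x) (V x) = ∫ x, inner ℝ (f x) (φ x) := by
    refine integral_congr_ae ?_
    filter_upwards [hf.coeFn_toLp, e2] with x hx1 hx2
    rw [hx1, hx2]
  have h3 : ∫ p, weightedStrain k (T w) p * weightedStrain k φ p =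
      ∫ p, inner ℝ (w.1 p) (hφ.memLp_weightedStrain.toLp _ p) := by
    refine integral_congr_ae ?_
    filter_upwards [(hT w).2, hφ.memLp_weightedStrain.coeFn_toLp] with p hp1 hp2
    rw [hp1, hp2]
    simp [mul_comm]
  rw [hF, h3, h1, h2]
  ring

/-- Testing the difference of the two equations with v - u shows that its strain vanishes; the
Poincaré inequality then gives v = u. -/
theorem IsWeakSolution.ae_eq {C : ℝ} (hP : HasPoincare k Ω C) (hF : FormEqStrain k)
    {f u v : RSpace d → RSpace d} (hu : IsWeakSolution k Ω f u) (hv : IsWeakSolution k Ω f v) :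
    v =ᵐ[volume] u := by
  have hz := hv.1.sub hu.1
  have h1 := (hv.2 _ hz).trans (hu.2 _ hz).symm
  rw [hF, hF] at h1
  have i1 := hv.1.memLp_weightedStrain.integrable_mul hz.memLp_weightedStrain
  have i2 := hu.1.memLp_weightedStrain.integrable_mul hz.memLp_weightedStrain
  have h2 : ∫ p, weightedStrain k (v - u) p ^ 2 = 0 := by
    have h3 := integral_sub i1 i2
    simp only [Pi.mul_apply] at h3
    have h4 : ∀ p, weightedStrain k (v - u) p ^ 2 =
        weightedStrain k v p * weightedStrain k (v - u) p -
          weightedStrain k u p * weightedStrain k (v - u) p := by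
      intro p
      rw [← sub_mul, sq, weightedStrain_sub, Pi.sub_apply]
    simp only [h4]
    rw [h3]
    linarith
  have h5 := hz.memLp_weightedStrain.integrable_sq
  have h6 := (integral_eq_zero_iff_of_nonneg (fun p => sq_nonneg _) h5).1 h2
  refine hP.ae_eq hv.1 hu.1 ?_
  filter_upwards [h6] with p hp
  rw [weightedStrain_sub] at hp
  simpa [sub_eq_zero] using hp

end

/-! ### Translation invariant kernels in the abstract framework -/

theorem formEqStrain_of_isLevyDensity (hK : IsLevyDensity K) :
    FormEqStrain fun x y : RSpace d => K (x - y) := by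
  intro u v
  simp only [nonlocalForm, antiPart_of_even hK.even, zero_mul, integral_zero, add_zero]
  congr 2
  funext p
  simp only [weightedStrain, symmPart_of_even hK.even]
  have := Real.mul_self_sqrt (hK.nonneg (p.1 - p.2))
  linear_combination -(nonlocalStrain u p.1 p.2 * nonlocalStrain v p.1 p.2) * this

theorem lpNorm_weightedStrain_sq (hK : IsLevyDensity K) {v : RSpace d → RSpace d}
    (hv : MemS (fun x y => K (x - y)) v) :
    lpNorm (weightedStrain (fun x y => K (x - y)) v) 2 volume ^ 2 = ∫ h, energyDensity K v h := by
  have h1 := nonlocalForm_self_eq hK hv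
  rw [formEqStrain_of_isLevyDensity hK] at h1
  have hv2 : MemLp (weightedStrain (fun x y => K (x - y)) v) 2 volume := hv.2
  rw [lpNorm_two_sq hv2]
  simp only [Real.norm_eq_abs, sq_abs]
  simp only [← sq] at h1
  linarith

theorem exists_hasPoincare (hK : IsLevyDensity K) {s : ℝ} {t₀ : RSpace d} {δ α : ℝ}
    (hE : IsConeElliptic K s t₀ δ α) {Ω : Set (RSpace d)} (hΩ : Bornology.IsBounded Ω) :
    ∃ C, HasPoincare (fun x y => K (x - y)) Ω C := by
  obtain ⟨C, hC0, hC⟩ := exists_lpNorm_sq_le_integral_energyDensity hK hE hΩ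
  refine ⟨Real.sqrt C, Real.sqrt_nonneg _, fun v hv => ?_⟩
  have h1 := hC v hv
  rw [← lpNorm_weightedStrain_sq hK hv.1] at h1
  refine abs_le_of_sq_le_sq' ?_ (mul_nonneg (Real.sqrt_nonneg _) lpNorm_nonneg) |>.2
  rwa [mul_pow, Real.sq_sqrt hC0.le]

/-! ### The Fourier transform of increments -/

/-- The Fourier multiplier `e^{2πi h·ξ} - 1` of the increment over `h`. -/
def incrSymbol (h ξ : RSpace d) : ℂ := (Real.fourierChar (inner ℝ h ξ) : ℂ) - 1

theorem continuous_incrSymbol : Continuous fun p : RSpace d × RSpace d => incrSymbol p.1 p.2 := by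
  unfold incrSymbol
  have := Real.continuous_fourierChar
  fun_prop

theorem norm_incrSymbol_eq (h ξ : RSpace d) :
    ‖incrSymbol h ξ‖ = 2 * |Real.sin (Real.pi * inner ℝ h ξ)| := by
  rw [incrSymbol, Real.fourierChar_apply]
  have := Complex.norm_exp_I_mul_ofReal_sub_one (2 * Real.pi * inner ℝ h ξ)
  rw [mul_comm] at this
  rw [this, Real.norm_eq_abs, abs_mul]
  norm_num
  congr 2
  ring

theorem norm_incrSymbol_le_two (h ξ : RSpace d) : ‖incrSymbol h ξ‖ ≤ 2 := by
  rw [norm_incrSymbol_eq]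
  have := Real.abs_sin_le_one (Real.pi * inner ℝ h ξ)
  linarith

theorem norm_incrSymbol_le (h ξ : RSpace d) :
    ‖incrSymbol h ξ‖ ≤ 2 * Real.pi * (‖h‖ * ‖ξ‖) := by
  rw [norm_incrSymbol_eq]
  have h1 : |Real.sin (Real.pi * inner ℝ h ξ)| ≤ |Real.pi * inner ℝ h ξ| := Real.abs_sin_le_abs
  rw [abs_mul, abs_of_pos Real.pi_pos] at h1
  have h2 := mul_le_mul_of_nonneg_left (abs_real_inner_le_norm h ξ) Real.pi_pos.le
  linarith

/-- Jordan's inequality sin x ≥ 2x/π on [0, π/2], applied to |e^(2πi h·ξ) - 1| = 2 |sin(π h·ξ)|. -/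
theorem le_norm_incrSymbol {h ξ : RSpace d} (hh : |inner ℝ h ξ| ≤ (1 / 2 : ℝ)) :
    4 * |inner ℝ h ξ| ≤ ‖incrSymbol h ξ‖ := by
  rw [norm_incrSymbol_eq]
  have h1 := Real.mul_le_sin (x := Real.pi * |inner ℝ h ξ|) (by positivity)
    (by have := mul_le_mul_of_nonneg_left hh Real.pi_pos.le; linarith)
  have h2 : 2 / Real.pi * (Real.pi * |inner ℝ h ξ|) = 2 * |inner ℝ h ξ| := by
    field_simp [Real.pi_ne_zero]
  rw [h2] at h1
  have h3 : |Real.sin (Real.pi * inner ℝ h ξ)| = |Real.sin (Real.pi * |inner ℝ h ξ|)| := by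
    rcases abs_cases (inner ℝ h ξ) with ⟨h4, _⟩ | ⟨h4, _⟩
    · rw [h4]
    · rw [h4, mul_neg, Real.sin_neg, abs_neg]
  rw [h3]
  linarith [le_abs_self (Real.sin (Real.pi * |inner ℝ h ξ|))]

section

variable {F : Type*} [NormedAddCommGroup F] [InnerProductSpace ℂ F]

theorem memLp_top_incrSymbol (h : RSpace d) :
    MemLp (incrSymbol h) ∞ (volume : Measure (RSpace d)) :=
  memLp_top_of_bound
    (continuous_incrSymbol.comp (Continuous.prodMk_right h)).aestronglyMeasurable 2
    (Filter.Eventually.of_forall fun ξ => norm_incrSymbol_le_two h ξ)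

/-- The increment over `h`, composed with a linear functional, on `L²`. -/
def incrementLp (L : F →L[ℂ] ℂ) (h : RSpace d) (W : Lp F 2 (volume : Measure (RSpace d))) :
    Lp ℂ 2 (volume : Measure (RSpace d)) :=
  L.compLpL 2 volume (Lp.compMeasurePreserving _ (measurePreserving_add_const h) W - W)

theorem continuous_incrementLp (L : F →L[ℂ] ℂ) (h : RSpace d) : Continuous (incrementLp L h) :=
  (L.compLpL 2 volume).continuous.comp
    ((Lp.isometry_compMeasurePreserving (measurePreserving_add_const h)).continuous.sub
      continuous_id)

theorem coeFn_incrementLp (L : F →L[ℂ] ℂ) (h : RSpace d)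
    (W : Lp F 2 (volume : Measure (RSpace d))) :
    incrementLp L h W =ᵐ[volume] fun x => L (W (x + h) - W x) := by
  filter_upwards [L.coeFn_compLp (Lp.compMeasurePreserving _ (measurePreserving_add_const h) W - W),
    Lp.coeFn_sub (Lp.compMeasurePreserving _ (measurePreserving_add_const h) W) W,
    Lp.coeFn_compMeasurePreserving W (measurePreserving_add_const h)] with x h1 h2 h3
  refine h1.trans ?_
  rw [h2, Pi.sub_apply, h3]
  rfl

/-- Multiplication by the symbol of the increment after a linear functional, on `L²`. -/
def symbolMulLp (L : F →L[ℂ] ℂ) (h : RSpace d) (V : Lp F 2 (volume : Measure (RSpace d))) :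
    Lp ℂ 2 (volume : Measure (RSpace d)) :=
  (ContinuousLinearMap.mul ℂ ℂ).holderL volume ∞ 2 2 ((memLp_top_incrSymbol h).toLp)
    (L.compLpL 2 volume V)

theorem continuous_symbolMulLp (L : F →L[ℂ] ℂ) (h : RSpace d) : Continuous (symbolMulLp L h) :=
  (ContinuousLinearMap.continuous _).comp (L.compLpL 2 volume).continuous

theorem coeFn_symbolMulLp (L : F →L[ℂ] ℂ) (h : RSpace d)
    (V : Lp F 2 (volume : Measure (RSpace d))) :
    symbolMulLp L h V =ᵐ[volume] fun ξ => incrSymbol h ξ * L (V ξ) := by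
  filter_upwards [(ContinuousLinearMap.mul ℂ ℂ).coeFn_holder (r := 2)
    ((memLp_top_incrSymbol h).toLp) (L.compLpL 2 volume V), (memLp_top_incrSymbol h).coeFn_toLp,
    L.coeFn_compLp V] with ξ h1 h2 h3
  simp only [symbolMulLp, ContinuousLinearMap.holderL_apply_apply, h1, h2,
    ContinuousLinearMap.mul_apply']
  congr 1

theorem incrementLp_toLp (L : F →L[ℂ] ℂ) (h : RSpace d) (f : SchwartzMap (RSpace d) F) :
    incrementLp L h (f.toLp 2) = ((f.compSubConstCLM ℂ (-h) - f).postcompCLM L).toLp 2 := by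
  apply Lp.ext
  have hsh := (measurePreserving_add_const h).quasiMeasurePreserving.ae (f.coeFn_toLp 2 volume)
  have h0 := SchwartzMap.coeFn_toLp ((f.compSubConstCLM ℂ (-h) - f).postcompCLM L) 2 volume
  filter_upwards [coeFn_incrementLp L h (f.toLp 2), h0, f.coeFn_toLp 2 volume, hsh]
    with x h1 h2 h3 h4
  rw [h1, h2, h3, h4]
  simp

variable [CompleteSpace F]

theorem SchwartzMap.fourier_increment_apply (f : SchwartzMap (RSpace d) F) (L : F →L[ℂ] ℂ)
    (h ξ : RSpace d) :
    𝓕 ((f.compSubConstCLM ℂ (-h) - f).postcompCLM L) ξ = incrSymbol h ξ * L (𝓕 f ξ) := by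
  have h1 : 𝓕 ((f.compSubConstCLM ℂ (-h) - f).postcompCLM L) ξ =
      L (𝓕 (f.compSubConstCLM ℂ (-h) - f) ξ) := by
    rw [SchwartzMap.fourier_coe, SchwartzMap.fourier_coe, Real.fourier_eq, Real.fourier_eq,
      ← L.integral_comp_comm]
    · simp [Circle.smul_def]
    · exact (Real.fourierIntegral_convergent_iff ξ).2
        (f.compSubConstCLM ℂ (-h) - f).integrable
  have h2 : 𝓕 (f.compSubConstCLM ℂ (-h) - f) = 𝓕 (f.compSubConstCLM ℂ (-h)) - 𝓕 f :=
    map_sub (SchwartzMap.fourierTransformCLM ℂ) _ _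
  have h3 : 𝓕 (f.compSubConstCLM ℂ (-h)) ξ = (Real.fourierChar (inner ℝ h ξ) : ℂ) • 𝓕 f ξ := by
    have := congrFun (VectorFourier.fourierIntegral_comp_add_right Real.fourierChar volume
      (innerₗ (RSpace d)) (f : RSpace d → F) h) ξ
    rw [SchwartzMap.fourier_coe, SchwartzMap.fourier_coe]
    convert! this using 2
    funext x
    simp
  rw [h1, h2, sub_apply, h3, incrSymbol, map_sub, map_smul, smul_eq_mul]
  ring

theorem symbolMulLp_toLp (L : F →L[ℂ] ℂ) (h : RSpace d) (f : SchwartzMap (RSpace d) F) :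
    symbolMulLp L h ((𝓕 f).toLp 2) =
      (𝓕 ((f.compSubConstCLM ℂ (-h) - f).postcompCLM L)).toLp 2 := by
  apply Lp.ext
  have h0 := SchwartzMap.coeFn_toLp
    (𝓕 ((f.compSubConstCLM ℂ (-h) - f).postcompCLM L)) 2 volume
  filter_upwards [h0, coeFn_symbolMulLp L h ((𝓕 f).toLp 2), (𝓕 f).coeFn_toLp 2 volume]
    with ξ h1 h2 h3
  rw [h1, h2, h3, SchwartzMap.fourier_increment_apply]

/-- Both sides are continuous in W, and for Schwartz functions, which are dense in L², this is the
translation rule of the Fourier transform. -/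
theorem fourier_incrementLp (L : F →L[ℂ] ℂ) (h : RSpace d)
    (W : Lp F 2 (volume : Measure (RSpace d))) :
    𝓕 (incrementLp L h W) = symbolMulLp L h (𝓕 W) := by
  have hFc : Continuous fun V : Lp ℂ 2 (volume : Measure (RSpace d)) => 𝓕 V :=
    (Lp.fourierTransformₗᵢ (RSpace d) ℂ).continuous
  have hFc' : Continuous fun V : Lp F 2 (volume : Measure (RSpace d)) => 𝓕 V :=
    (Lp.fourierTransformₗᵢ (RSpace d) F).continuous
  refine DenseRange.induction_on
    (p := fun W : Lp F 2 (volume : Measure (RSpace d)) =>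
      𝓕 (incrementLp L h W) = symbolMulLp L h (𝓕 W))
    (SchwartzMap.denseRange_toLpCLM (p := 2) ENNReal.ofNat_ne_top) W
    (isClosed_eq (hFc.comp (continuous_incrementLp L h))
      ((continuous_symbolMulLp L h).comp hFc')) fun f => ?_
  change 𝓕 (incrementLp L h (f.toLp 2)) = symbolMulLp L h (𝓕 (f.toLp 2))
  rw [incrementLp_toLp, SchwartzMap.toLp_fourier_eq, SchwartzMap.toLp_fourier_eq, symbolMulLp_toLp]

end

/-! ### Real and complex vector fields -/

/-- The functional `v ↦ v · e` on `ℂᵈ`, for a real vector `e`. -/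
def complexInner (e : RSpace d) : CSpace d →L[ℂ] ℂ := innerSL ℂ (toComplexVec e)

/-- The real part of a vector of `ℂᵈ`. -/
def reVec (v : CSpace d) : RSpace d := WithLp.toLp 2 fun i => (v i).re

/-- The imaginary part of a vector of `ℂᵈ`. -/
def imVec (v : CSpace d) : RSpace d := WithLp.toLp 2 fun i => (v i).im

theorem norm_sq_reVec_add_norm_sq_imVec (v : CSpace d) :
    ‖reVec v‖ ^ 2 + ‖imVec v‖ ^ 2 = ‖v‖ ^ 2 := by
  rw [EuclideanSpace.norm_sq_eq, EuclideanSpace.norm_sq_eq, EuclideanSpace.norm_sq_eq,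
    ← Finset.sum_add_distrib]
  refine Finset.sum_congr rfl fun i _ => ?_
  rw [Complex.sq_norm, Complex.normSq_apply]
  simp [reVec, imVec, sq]

theorem norm_reVec_le (v : CSpace d) : ‖reVec v‖ ≤ ‖v‖ := by
  have := norm_sq_reVec_add_norm_sq_imVec v
  exact abs_le_of_sq_le_sq' (by nlinarith [sq_nonneg ‖imVec v‖]) (norm_nonneg _) |>.2

theorem continuous_reVec : Continuous (reVec (d := d)) := by
  unfold reVec
  fun_prop

theorem complexInner_apply_re (e : RSpace d) (v : CSpace d) :
    (complexInner e v).re = inner ℝ (reVec v) e := by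
  simp [complexInner, reVec, toComplexVec, PiLp.inner_apply, mul_comm]

theorem complexInner_apply_im (e : RSpace d) (v : CSpace d) :
    (complexInner e v).im = inner ℝ (imVec v) e := by
  simp [complexInner, imVec, toComplexVec, PiLp.inner_apply, mul_comm]

theorem complexInner_toComplexVec (e v : RSpace d) :
    complexInner e (toComplexVec v) = (inner ℝ v e : ℝ) := by
  simp [complexInner, toComplexVec, PiLp.inner_apply, mul_comm]

theorem toComplexVec_sub (v w : RSpace d) :
    toComplexVec (v - w) = toComplexVec v - toComplexVec w := by
  ext i
  simp [toComplexVec]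

theorem reVec_sub (v w : CSpace d) : reVec (v - w) = reVec v - reVec w := by
  ext i
  simp [reVec]

theorem norm_complexInner_apply_le {e : RSpace d} (he : ‖e‖ ≤ 1) (v : CSpace d) :
    ‖complexInner e v‖ ≤ ‖v‖ := by
  refine (norm_inner_le_norm (𝕜 := ℂ) (toComplexVec e) v).trans ?_
  rw [norm_toComplexVec]
  exact mul_le_of_le_one_left (norm_nonneg _) he

theorem norm_sq_complexInner (e : RSpace d) (v : CSpace d) :
    ‖complexInner e v‖ ^ 2 = inner ℝ (reVec v) e ^ 2 + inner ℝ (imVec v) e ^ 2 := by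
  rw [Complex.sq_norm, Complex.normSq_apply, complexInner_apply_re, complexInner_apply_im]
  ring

/-- The functional giving the directional component along `h`. -/
def dirComponent (h : RSpace d) : CSpace d →L[ℂ] ℂ := complexInner (‖h‖⁻¹ • h)

/-! ### The increments of a field on the Fourier side -/

theorem incrementLp_complexL2 {w : RSpace d → RSpace d} (hw : MemLp w 2 volume) (h : RSpace d) :
    incrementLp (dirComponent h) h (complexL2 w hw) =ᵐ[volume]
      fun x => ((strainIncr h w x : ℝ) : ℂ) := by
  have e : complexL2 w hw =ᵐ[volume] fun x => toComplexVec (w x) :=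
    (memLp_toComplexVec hw).coeFn_toLp
  have e2 := (measurePreserving_add_const h).quasiMeasurePreserving.ae e
  filter_upwards [coeFn_incrementLp (dirComponent h) h (complexL2 w hw), e, e2] with x h1 h2 h3
  rw [h1, h2, h3, ← toComplexVec_sub, dirComponent, complexInner_toComplexVec, strainIncr]

theorem incrementLp_re (Φ : Lp (CSpace d) 2 (volume : Measure (RSpace d))) (h : RSpace d) :
    (fun x => (incrementLp (dirComponent h) h Φ x).re) =ᵐ[volume]
      strainIncr h fun x => reVec (Φ x) := by
  filter_upwards [coeFn_incrementLp (dirComponent h) h Φ] with x h1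
  rw [h1, dirComponent, complexInner_apply_re, reVec_sub, strainIncr]

theorem memLp_reVec (Φ : Lp (CSpace d) 2 (volume : Measure (RSpace d))) :
    MemLp (fun x => reVec (Φ x)) 2 volume :=
  (Lp.memLp Φ).of_le (continuous_reVec.comp_aestronglyMeasurable (Lp.memLp Φ).1)
    (Filter.Eventually.of_forall fun _ => norm_reVec_le _)

theorem lpNorm_reVec_le (Φ : Lp (CSpace d) 2 (volume : Measure (RSpace d))) :
    lpNorm (fun x => reVec (Φ x)) 2 volume ≤ ‖Φ‖ := by
  have := lpNorm_le_mul_lpNorm zero_le_one (memLp_reVec Φ).1 (Lp.memLp Φ)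
    (Filter.Eventually.of_forall fun _ => by rw [one_mul]; exact norm_reVec_le _)
  rwa [one_mul, ← toReal_eLpNorm (Lp.memLp Φ).1, ← Lp.norm_def] at this

/-- Plancherel for the increments. Those of w are real, so taking the real part of Φ amounts to
taking the real part of the inner product, and a real multiplier g leaves a weighted square. -/
theorem integral_strainIncr_mul_reVec {w : RSpace d → RSpace d} (hw : MemLp w 2 volume)
    {Φ : Lp (CSpace d) 2 (volume : Measure (RSpace d))} {g : RSpace d → ℝ}
    (hΦ : (𝓕 Φ : Lp (CSpace d) 2 (volume : Measure (RSpace d))) =ᵐ[volume]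
      fun ξ => (g ξ : ℂ) • (𝓕 (complexL2 w hw) : Lp (CSpace d) 2 (volume : Measure (RSpace d))) ξ)
    (h : RSpace d) :
    Integrable (fun ξ => g ξ * ‖incrSymbol h ξ * dirComponent h
      ((𝓕 (complexL2 w hw) : Lp (CSpace d) 2 (volume : Measure (RSpace d))) ξ)‖ ^ 2) volume ∧
    ∫ x, strainIncr h w x * strainIncr h (fun x => reVec (Φ x)) x =
      ∫ ξ, g ξ * ‖incrSymbol h ξ * dirComponent h
        ((𝓕 (complexL2 w hw) : Lp (CSpace d) 2 (volume : Measure (RSpace d))) ξ)‖ ^ 2 := by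
  set W := complexL2 w hw with hW
  set L := dirComponent h with hL
  have h1 : ∫ x, strainIncr h w x * strainIncr h (fun x => reVec (Φ x)) x =
      (inner ℂ (incrementLp L h W) (incrementLp L h Φ)).re := by
    rw [L2.inner_def, ← Complex.reCLM_apply, ← Complex.reCLM.integral_comp_comm
      (L2.integrable_inner _ _)]
    refine integral_congr_ae ?_
    filter_upwards [incrementLp_complexL2 hw h, incrementLp_re Φ h] with x h2 h3
    rw [h2, ← h3]
    simp [mul_comm, hL]
  have h2 : inner ℂ (incrementLp L h W) (incrementLp L h Φ) =
      inner ℂ (symbolMulLp L h (𝓕 W)) (symbolMulLp L h (𝓕 Φ)) := by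
    rw [← fourier_incrementLp, ← fourier_incrementLp, Lp.inner_fourier_eq]
  have h3 : (fun ξ => (inner ℂ (symbolMulLp L h (𝓕 W) ξ) (symbolMulLp L h (𝓕 Φ) ξ)).re) =ᵐ[volume]
      fun ξ => g ξ * ‖incrSymbol h ξ * L
        ((𝓕 W : Lp (CSpace d) 2 (volume : Measure (RSpace d))) ξ)‖ ^ 2 := by
    filter_upwards [coeFn_symbolMulLp L h (𝓕 W), coeFn_symbolMulLp L h (𝓕 Φ), hΦ] with ξ e1 e2 e3
    rw [e1, e2, e3, map_smul, smul_eq_mul, mul_left_comm, ← smul_eq_mul (g ξ : ℂ), inner_smul_right,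
      inner_self_eq_norm_sq_to_K]
    norm_cast
    rw [Complex.re_ofReal_mul]
    rfl
  have h4 := L2.integrable_inner (𝕜 := ℂ) (symbolMulLp L h (𝓕 W)) (symbolMulLp L h (𝓕 Φ))
  refine ⟨(integrable_congr h3).1 h4.re, ?_⟩
  rw [h1, h2, L2.inner_def, ← Complex.reCLM_apply, ← Complex.reCLM.integral_comp_comm h4]
  exact integral_congr_ae h3

/-- On the band |ξ| < R the symbol of the increment is at most 2 and at most 2πR|h|; as R ≥ 1, both
fit under 2πR min(1, |h|). -/
theorem lpNorm_strainIncr_reVec_le {Φ : Lp (CSpace d) 2 (volume : Measure (RSpace d))} {R : ℝ}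
    (hR : 1 ≤ R) (hΦ : ∀ᵐ ξ, R ≤ ‖ξ‖ →
      (𝓕 Φ : Lp (CSpace d) 2 (volume : Measure (RSpace d))) ξ = 0) (h : RSpace d) :
    lpNorm (strainIncr h fun x => reVec (Φ x)) 2 volume ≤ 2 * Real.pi * R * min 1 ‖h‖ * ‖Φ‖ := by
  set L := dirComponent h with hL
  have h1 : lpNorm (strainIncr h fun x => reVec (Φ x)) 2 volume ≤ ‖incrementLp L h Φ‖ := by
    have h2 := lpNorm_le_mul_lpNorm (f := strainIncr h fun x => reVec (Φ x))
      (g := incrementLp L h Φ) zero_le_one (memLp_strainIncr (memLp_reVec Φ) h).1 (Lp.memLp _) ?_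
    · rwa [one_mul, ← toReal_eLpNorm (Lp.memLp _).1, ← Lp.norm_def] at h2
    · filter_upwards [incrementLp_re Φ h] with x hx
      rw [one_mul, ← hx, Real.norm_eq_abs]
      exact Complex.abs_re_le_norm _
  have h2 : ‖incrementLp L h Φ‖ = ‖symbolMulLp L h (𝓕 Φ)‖ := by
    rw [← fourier_incrementLp, Lp.norm_fourier_eq]
  have h3 : ‖symbolMulLp L h (𝓕 Φ)‖ ≤ 2 * Real.pi * R * min 1 ‖h‖ * ‖𝓕 Φ‖ := by
    refine Lp.norm_le_mul_norm_of_ae_le_mul ?_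
    filter_upwards [coeFn_symbolMulLp L h (𝓕 Φ), hΦ] with ξ e1 e2
    rw [e1]
    have hpi := Real.two_le_pi
    by_cases hξ : R ≤ ‖ξ‖
    · simp [e2 hξ]
    · rw [norm_mul]
      push Not at hξ
      have e3 : ‖incrSymbol h ξ‖ ≤ 2 * Real.pi * R * min 1 ‖h‖ := by
        rcases min_cases 1 ‖h‖ with ⟨e, _⟩ | ⟨e, _⟩
        · rw [e]
          have := norm_incrSymbol_le_two h ξ
          nlinarith
        · rw [e]
          refine (norm_incrSymbol_le h ξ).trans ?_
          have : ‖h‖ * ‖ξ‖ ≤ ‖h‖ * R := by gcongr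
          nlinarith
      have e4 := norm_complexInner_apply_le (norm_inv_smul_self_le h)
        ((𝓕 Φ : Lp (CSpace d) 2 (volume : Measure (RSpace d))) ξ)
      exact mul_le_mul e3 e4 (norm_nonneg _) (by positivity)
  rw [Lp.norm_fourier_eq] at h3
  exact h1.trans (h2.le.trans h3)

/-! ### Criteria for finite energy -/

theorem aestronglyMeasurable_energyDensity (hK : IsLevyDensity K) {v : RSpace d → RSpace d}
    (hv : MemLp v 2 volume) : AEStronglyMeasurable (energyDensity K v) volume := by
  have h1 := ((aestronglyMeasurable_strainIncr hv.1).pow 2)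
  rw [Measure.volume_eq_prod] at h1
  refine hK.measurable.aestronglyMeasurable.mul (h1.integral_prod_right'.congr ?_)
  exact Filter.Eventually.of_forall fun h => (lpNorm_strainIncr_sq hv h).symm

theorem memS_of_energyDensity_le (hK : IsLevyDensity K) {v : RSpace d → RSpace d}
    (hv : MemLp v 2 volume) {G : RSpace d → ℝ} (hG : Integrable G volume)
    (hle : ∀ h, energyDensity K v h ≤ G h) : MemS (fun x y => K (x - y)) v := by
  rw [memS_iff_integrable_energyDensity hK hv]
  refine hG.mono' (aestronglyMeasurable_energyDensity hK hv) (Filter.Eventually.of_forall fun h => ?_)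
  rw [Real.norm_of_nonneg
    (show 0 ≤ energyDensity K v h from mul_nonneg (hK.nonneg h) (sq_nonneg _))]
  exact hle h

theorem memS_reVec (hK : IsLevyDensity K) {Φ : Lp (CSpace d) 2 (volume : Measure (RSpace d))}
    {R : ℝ} (hR : 1 ≤ R) (hΦ : ∀ᵐ ξ, R ≤ ‖ξ‖ →
      (𝓕 Φ : Lp (CSpace d) 2 (volume : Measure (RSpace d))) ξ = 0) :
    MemS (fun x y => K (x - y)) fun x => reVec (Φ x) := by
  refine memS_of_energyDensity_le hK (memLp_reVec Φ)
    (hK.integrable_min.const_mul ((2 * Real.pi * R * ‖Φ‖) ^ 2)) fun h => ?_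
  have h1 := pow_le_pow_left₀ lpNorm_nonneg (lpNorm_strainIncr_reVec_le hR hΦ h) 2
  refine (mul_le_mul_of_nonneg_left h1 (hK.nonneg h)).trans (le_of_eq ?_)
  ring

/-! ### The multiplier of the form is bounded below -/

theorem lintegral_smul_comp (G : RSpace d → ℝ≥0∞) (hG : Measurable G) {l : ℝ} (hl : 0 < l) :
    ∫⁻ h, G h = ENNReal.ofReal ((l ^ d)⁻¹) * ∫⁻ t, G (l⁻¹ • t) := by
  have h1 : ∫⁻ t, G (l⁻¹ • t) = ∫⁻ h, G h ∂(Measure.map (l⁻¹ • ·) volume) :=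
    (lintegral_map hG (measurable_const_smul _)).symm
  rw [h1, Measure.map_addHaar_smul volume (inv_ne_zero hl.ne'), lintegral_smul_measure,
    finrank_euclideanSpace_fin, smul_eq_mul, ← mul_assoc, ← ENNReal.ofReal_mul (by positivity),
    abs_of_nonneg (by positivity)]
  rw [inv_pow, inv_inv, inv_mul_cancel₀ (by positivity), ENNReal.ofReal_one, one_mul]

theorem measurable_complexInner_apply (v : CSpace d) :
    Measurable fun h : RSpace d => dirComponent h v := by
  have : Measurable fun h : RSpace d => toComplexVec (‖h‖⁻¹ • h) :=
    continuous_toComplexVec.measurable.comp (by fun_prop)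
  exact this.inner measurable_const

/-- Substitute h = t/|ξ| and keep only t ∈ B. There K contributes |ξ|^(d+2s), the Jacobian |ξ|^(-d),
and the symbol is bounded below by its linear part, which leaves the quartic integral over B. The
complex vector v is handled through its real and imaginary parts. -/
theorem exists_le_lintegral_symbol (hK : IsLevyDensity K) {s : ℝ} {t₀ : RSpace d} {δ α : ℝ}
    (hE : IsConeElliptic K s t₀ δ α) :
    ∃ c : ℝ, 0 < c ∧ ∀ (ξ : RSpace d) (v : CSpace d), 1 ≤ ‖ξ‖ →
      ENNReal.ofReal (c * ‖ξ‖ ^ (2 * s) * ‖v‖ ^ 2) ≤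
        ∫⁻ h, ENNReal.ofReal (K h * ‖incrSymbol h ξ * dirComponent h v‖ ^ 2) := by
  obtain ⟨c, hc0, hc⟩ := exists_le_setIntegral_inner_sq_mul_inner_sq t₀ hE.radius_pos
  have hα := hE.const_pos
  -- 64 = 4² · 4: the square of the constant in the symbol bound, times |t|⁻² ≥ 4 from normalizing
  -- the direction.
  refine ⟨64 * α * c, by positivity, fun ξ v hξ => ?_⟩
  set l := ‖ξ‖ with hl
  have hl0 : 0 < l := one_pos.trans_le hξ
  have hGm : Measurable fun h : RSpace d =>
      ENNReal.ofReal (K h * ‖incrSymbol h ξ * dirComponent h v‖ ^ 2) := by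
    have h1 : Measurable fun h : RSpace d => incrSymbol h ξ :=
      (continuous_incrSymbol.comp (Continuous.prodMk_left ξ)).measurable
    exact (hK.measurable.mul ((h1.mul (measurable_complexInner_apply v)).norm.pow_const 2)).ennreal_ofReal
  set B := Metric.closedBall t₀ δ with hB
  have hBc : IsCompact B := isCompact_closedBall _ _
  set P : RSpace d → ℝ := fun t => inner ℝ ξ t ^ 2 * inner ℝ (reVec v) t ^ 2 +
    inner ℝ ξ t ^ 2 * inner ℝ (imVec v) t ^ 2 with hP
  have hpt : ∀ t ∈ B, 64 * α * l ^ ((d : ℝ) + 2 * s - 2) * P t ≤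
      K (l⁻¹ • t) * ‖incrSymbol (l⁻¹ • t) ξ * dirComponent (l⁻¹ • t) v‖ ^ 2 := by
    intro t ht
    have ht0 : 0 < ‖t‖ := norm_pos_iff.2 (hE.ne_zero t ht)
    have htn := hE.norm_le t ht
    have h1 := hE.lower t ht l hξ
    have hin : inner ℝ (l⁻¹ • t) ξ = l⁻¹ * inner ℝ ξ t := by
      rw [real_inner_smul_left, real_inner_comm]
    have h2 : |inner ℝ (l⁻¹ • t) ξ| ≤ (1 / 2 : ℝ) := by
      rw [hin, abs_mul, abs_of_pos (inv_pos.2 hl0), inv_mul_le_iff₀ hl0]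
      refine (abs_real_inner_le_norm ξ t).trans ?_
      gcongr
    have h3 := pow_le_pow_left₀ (by positivity) (le_norm_incrSymbol h2) 2
    rw [hin, mul_pow, sq_abs, mul_pow, inv_pow] at h3
    have hdir : dirComponent (l⁻¹ • t) v = complexInner (‖t‖⁻¹ • t) v := by
      rw [dirComponent, norm_smul, Real.norm_of_nonneg (inv_nonneg.2 hl0.le), smul_smul]
      congr 3
      field_simp
    have h4 : 4 * (inner ℝ (reVec v) t ^ 2 + inner ℝ (imVec v) t ^ 2) ≤
        ‖dirComponent (l⁻¹ • t) v‖ ^ 2 := by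
      rw [hdir, norm_sq_complexInner, real_inner_smul_right, real_inner_smul_right, mul_pow,
        mul_pow, ← mul_add]
      gcongr
      rw [inv_pow]
      refine (le_inv_comm₀ (by norm_num) (by positivity)).2 ?_
      nlinarith
    rw [norm_mul, mul_pow]
    calc 64 * α * l ^ ((d : ℝ) + 2 * s - 2) * P t
        = (α * l ^ ((d : ℝ) + 2 * s)) * ((4 ^ 2 * ((l ^ 2)⁻¹ * inner ℝ ξ t ^ 2)) *
          (4 * (inner ℝ (reVec v) t ^ 2 + inner ℝ (imVec v) t ^ 2))) := by
          rw [Real.rpow_sub hl0, hP]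
          norm_num
          field_simp
          ring
      _ ≤ _ := by gcongr; exact hK.nonneg _
  have hPi : IntegrableOn P B volume := ContinuousOn.integrableOn_compact hBc (by fun_prop)
  have hPc : c * (l ^ 2 * ‖v‖ ^ 2) ≤ ∫ t in B, P t := by
    have i1 : IntegrableOn (fun t => inner ℝ ξ t ^ 2 * inner ℝ (reVec v) t ^ 2) B volume :=
      ContinuousOn.integrableOn_compact hBc (by fun_prop)
    have i2 : IntegrableOn (fun t => inner ℝ ξ t ^ 2 * inner ℝ (imVec v) t ^ 2) B volume :=
      ContinuousOn.integrableOn_compact hBc (by fun_prop)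
    rw [hP, integral_add i1 i2, ← norm_sq_reVec_add_norm_sq_imVec v, mul_add, mul_add]
    exact add_le_add (hc ξ (reVec v)) (hc ξ (imVec v))
  have hP0 : ∀ t, 0 ≤ 64 * α * l ^ ((d : ℝ) + 2 * s - 2) * P t := fun t => by positivity
  rw [lintegral_smul_comp _ hGm hl0]
  calc ENNReal.ofReal (64 * α * c * l ^ (2 * s) * ‖v‖ ^ 2)
      = ENNReal.ofReal ((l ^ d)⁻¹) * ENNReal.ofReal (64 * α * l ^ ((d : ℝ) + 2 * s - 2) *
          (c * (l ^ 2 * ‖v‖ ^ 2))) := by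
        rw [← ENNReal.ofReal_mul (by positivity), Real.rpow_sub hl0, Real.rpow_add hl0,
          Real.rpow_natCast]
        congr 1
        norm_num
        field_simp
    _ ≤ ENNReal.ofReal ((l ^ d)⁻¹) * ENNReal.ofReal (64 * α * l ^ ((d : ℝ) + 2 * s - 2) *
          ∫ t in B, P t) := by gcongr
    _ = ENNReal.ofReal ((l ^ d)⁻¹) * ∫⁻ t in B, ENNReal.ofReal
          (64 * α * l ^ ((d : ℝ) + 2 * s - 2) * P t) := by
        rw [← integral_const_mul, ofReal_integral_eq_lintegral_ofReal (hPi.const_mul _)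
          (Filter.Eventually.of_forall hP0)]
    _ ≤ ENNReal.ofReal ((l ^ d)⁻¹) * ∫⁻ t in B, ENNReal.ofReal
          (K (l⁻¹ • t) * ‖incrSymbol (l⁻¹ • t) ξ * dirComponent (l⁻¹ • t) v‖ ^ 2) := by
        refine mul_le_mul_right ?_ _
        refine setLIntegral_mono' hBc.measurableSet fun t ht => ?_
        exact ENNReal.ofReal_le_ofReal (hpt t ht)
    _ ≤ _ := mul_le_mul_right (setLIntegral_le_lintegral _ _) _

/-! ### Multiplication by a cutoff function -/

/-- Bounds for a function, its increments and its second order increments. -/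
structure HasIncrBound (η : RSpace d → ℝ) (C : ℝ) : Prop where
  continuous : Continuous η
  nonneg : 0 ≤ C
  bound : ∀ x, |η x| ≤ C
  incr : ∀ x h, |η (x + h) - η x| ≤ C * min 1 ‖h‖
  incr_two : ∀ x h, |2 * η x - η (x - h) - η (x + h)| ≤ C * min 1 ‖h‖ ^ 2

theorem exists_hasIncrBound {η : RSpace d → ℝ} (hη : ContDiff ℝ ∞ η) (hc : HasCompactSupport η) :
    ∃ C, HasIncrBound η C := by
  obtain ⟨C₀, hC₀⟩ := hc.exists_bound_of_continuous hη.continuous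
  obtain ⟨C₁, hC₁⟩ := ContDiff.lipschitzWith_of_hasCompactSupport hc hη (by simp)
  have hfc : ContDiff ℝ ∞ (fderiv ℝ η) := hη.fderiv_right (by simp)
  obtain ⟨C₂, hC₂⟩ := ContDiff.lipschitzWith_of_hasCompactSupport (hc.fderiv (𝕜 := ℝ)) hfc (by simp)
  have h0 : ∀ x, |η x| ≤ C₀ := hC₀
  have hC₀' : 0 ≤ C₀ := (abs_nonneg _).trans (h0 0)
  have h1 : ∀ x h, |η (x + h) - η x| ≤ C₁ * ‖h‖ := by
    intro x h
    have := hC₁.dist_le_mul (x + h) x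
    rwa [Real.dist_eq, dist_eq_norm, add_sub_cancel_left] at this
  have h2 : ∀ x h, |η (x + h) - η x - fderiv ℝ η x h| ≤ C₂ * ‖h‖ * ‖h‖ := by
    intro x h
    have := Convex.norm_image_sub_le_of_norm_fderiv_le' (𝕜 := ℝ) (f := η) (φ := fderiv ℝ η x)
      (s := Metric.closedBall x ‖h‖) (C := C₂ * ‖h‖) (x := x) (y := x + h)
      (fun y _ => (hη.differentiable (by simp)) y) (fun y hy => ?_) (convex_closedBall _ _)
      (Metric.mem_closedBall_self (norm_nonneg _)) (by simp)
    · simpa [Real.norm_eq_abs] using this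
    · have h3 := hC₂.dist_le_mul y x
      rw [dist_eq_norm] at h3
      refine h3.trans ?_
      gcongr
      exact hy
  -- For |h| ≥ 1 the sup bound C₀ suffices, with weight 4 in the second difference. For small |h|,
  -- C₁ bounds first differences, and two Taylor remainders C₂|h|² bound the second.
  refine ⟨4 * C₀ + C₁ + 2 * C₂, hη.continuous, by positivity, fun x => ?_, fun x h => ?_,
    fun x h => ?_⟩
  · have := h0 x
    have : (0 : ℝ) ≤ C₁ := C₁.2
    have : (0 : ℝ) ≤ C₂ := C₂.2
    linarith
  · rcases min_cases 1 ‖h‖ with ⟨e, _⟩ | ⟨e, _⟩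
    · rw [e, mul_one]
      refine (abs_sub _ _).trans ?_
      have h3 := h0 x
      have h4 := h0 (x + h)
      have : (0 : ℝ) ≤ C₁ := C₁.2
      have : (0 : ℝ) ≤ C₂ := C₂.2
      linarith
    · rw [e]
      refine (h1 x h).trans ?_
      gcongr
      have : (0 : ℝ) ≤ C₂ := C₂.2
      linarith
  · rcases min_cases 1 ‖h‖ with ⟨e, _⟩ | ⟨e, _⟩
    · rw [e, one_pow, mul_one]
      have h3 := h0 x
      have h4 := h0 (x + h)
      have h5 := h0 (x - h)
      have : (0 : ℝ) ≤ C₁ := C₁.2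
      have : (0 : ℝ) ≤ C₂ := C₂.2
      rw [abs_le] at *
      constructor <;> linarith
    · rw [e]
      have h3 := h2 x h
      have h4 := h2 x (-h)
      rw [norm_neg, map_neg, ← sub_eq_add_neg] at h4
      have h5 : |2 * η x - η (x - h) - η (x + h)| ≤ 2 * C₂ * ‖h‖ ^ 2 := by
        rw [abs_le] at *
        constructor <;> nlinarith
      refine h5.trans ?_
      gcongr
      have : (0 : ℝ) ≤ C₁ := C₁.2
      linarith

section

variable {η : RSpace d → ℝ} {C : ℝ} {u φ : RSpace d → RSpace d}

theorem memLp_bounded_mul {F : Type*} [NormedAddCommGroup F] [NormedSpace ℝ F] {q : RSpace d → ℝ}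
    (hq : Continuous q) {c : ℝ} (hqc : ∀ x, |q x| ≤ c) {a : RSpace d → F} (ha : MemLp a 2 volume) :
    MemLp (fun x => q x • a x) 2 volume :=
  ha.of_le_mul (c := c) (hq.aestronglyMeasurable.smul ha.1) (Filter.Eventually.of_forall fun x => by
    rw [norm_smul]
    exact mul_le_mul_of_nonneg_right (hqc x) (norm_nonneg _))

theorem lpNorm_bounded_mul_le {F : Type*} [NormedAddCommGroup F] [NormedSpace ℝ F]
    {q : RSpace d → ℝ} (hq : Continuous q) {c : ℝ} (hqc : ∀ x, |q x| ≤ c) {a : RSpace d → F}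
    (ha : MemLp a 2 volume) : lpNorm (fun x => q x • a x) 2 volume ≤ c * lpNorm a 2 volume :=
  lpNorm_le_mul_lpNorm ((abs_nonneg _).trans (hqc 0)) (memLp_bounded_mul hq hqc ha).1 ha
    (Filter.Eventually.of_forall fun x => by
      rw [norm_smul]
      exact mul_le_mul_of_nonneg_right (hqc x) (norm_nonneg _))

theorem HasIncrBound.memLp_smul (hη : HasIncrBound η C) (hu : MemLp u 2 volume) :
    MemLp (fun x => η x • u x) 2 volume := memLp_bounded_mul hη.continuous hη.bound hu

theorem HasIncrBound.lpNorm_smul_le (hη : HasIncrBound η C) (hu : MemLp u 2 volume) :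
    lpNorm (fun x => η x • u x) 2 volume ≤ C * lpNorm u 2 volume :=
  lpNorm_bounded_mul_le hη.continuous hη.bound hu

theorem lpNorm_inner_const_le (hu : MemLp u 2 volume) {e : RSpace d} (he : ‖e‖ ≤ 1) :
    lpNorm (fun x => inner ℝ (u x) e) 2 volume ≤ lpNorm u 2 volume := by
  have h := lpNorm_le_mul_lpNorm (f := fun x => (inner ℝ (u x) e : ℝ)) zero_le_one
    (hu.inner_const e).1 hu (Filter.Eventually.of_forall fun x => ?_)
  · rwa [one_mul] at h
  · rw [one_mul]
    exact (norm_inner_le_norm _ _).trans (mul_le_of_le_one_right (norm_nonneg _) he)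

theorem strainIncr_smul (h x : RSpace d) :
    strainIncr h (fun x => η x • u x) x =
      η (x + h) * inner ℝ (u (x + h)) (‖h‖⁻¹ • h) - η x * inner ℝ (u x) (‖h‖⁻¹ • h) := by
  rw [strainIncr_eq, real_inner_smul_left, real_inner_smul_left]

theorem HasIncrBound.lpNorm_strainIncr_smul_le (hη : HasIncrBound η C) (hu : MemLp u 2 volume)
    (h : RSpace d) :
    lpNorm (strainIncr h fun x => η x • u x) 2 volume ≤
      C * lpNorm (strainIncr h u) 2 volume + C * min 1 ‖h‖ * lpNorm u 2 volume := by
  have hηc := hη.continuous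
  set a : RSpace d → ℝ := fun x => inner ℝ (u x) (‖h‖⁻¹ • h) with ha
  have ham : MemLp a 2 volume := hu.inner_const _
  have e : (strainIncr h fun x => η x • u x) =
      (fun x => η (x + h) • strainIncr h u x) + fun x => (η (x + h) - η x) • a x := by
    funext x
    rw [strainIncr_smul, Pi.add_apply, strainIncr_eq, smul_eq_mul, smul_eq_mul]
    ring
  have h1 := memLp_bounded_mul (q := fun x => η (x + h)) (by fun_prop)
    (fun x => hη.bound (x + h)) (memLp_strainIncr hu h)
  have h2 := lpNorm_bounded_mul_le (q := fun x => η (x + h)) (by fun_prop)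
    (fun x => hη.bound (x + h)) (memLp_strainIncr hu h)
  have h3 := lpNorm_bounded_mul_le (q := fun x => η (x + h) - η x) (by fun_prop)
    (fun x => hη.incr x h) ham
  have h4 : lpNorm a 2 volume ≤ lpNorm u 2 volume :=
    lpNorm_inner_const_le hu (norm_inv_smul_self_le h)
  have h5 : 0 ≤ C * min 1 ‖h‖ := mul_nonneg hη.nonneg (by positivity)
  rw [e]
  refine (lpNorm_add_le h1 (by norm_num)).trans ?_
  have := mul_le_mul_of_nonneg_left h4 h5
  linarith

theorem HasIncrBound.memS_smul (hK : IsLevyDensity K) (hη : HasIncrBound η C)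
    (hu : MemS (fun x y => K (x - y)) u) : MemS (fun x y => K (x - y)) fun x => η x • u x := by
  refine memS_of_energyDensity_le hK (hη.memLp_smul hu.1)
    (((hu.integrable_energyDensity hK).const_mul (2 * C ^ 2)).add
      (hK.integrable_min.const_mul (2 * C ^ 2 * lpNorm u 2 volume ^ 2))) fun h => ?_
  have h1 := pow_le_pow_left₀ lpNorm_nonneg (hη.lpNorm_strainIncr_smul_le hu.1 h) 2
  have h2 := add_sq_le (a := C * lpNorm (strainIncr h u) 2 volume)
    (b := C * min 1 ‖h‖ * lpNorm u 2 volume)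
  refine (mul_le_mul_of_nonneg_left (h1.trans h2) (hK.nonneg h)).trans (le_of_eq ?_)
  rw [Pi.add_apply]
  simp only [energyDensity]
  ring

/-- The product rule leaves increments of η only. The terms without D_h u combine, after a
translation, into a second difference of η and gain min(1, |h|)²; the remaining term pairs min(1,
|h|) with D_h u. No increment of φ is needed. -/
theorem HasIncrBound.commutator_le (hη : HasIncrBound η C) (hu : MemLp u 2 volume)
    (hφ : MemLp φ 2 volume) (h : RSpace d) :
    |(∫ x, strainIncr h (fun x => η x • u x) x * strainIncr h φ x) -
      ∫ x, strainIncr h u x * strainIncr h (fun x => η x • φ x) x| ≤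
    C * lpNorm φ 2 volume * (min 1 ‖h‖ ^ 2 * lpNorm u 2 volume +
      2 * (min 1 ‖h‖ * lpNorm (strainIncr h u) 2 volume)) := by
  have hηc := hη.continuous
  set e := ‖h‖⁻¹ • h with he
  have he1 : ‖e‖ ≤ 1 := norm_inv_smul_self_le h
  set a : RSpace d → ℝ := fun x => inner ℝ (u x) e with ha
  set b : RSpace d → ℝ := fun x => inner ℝ (φ x) e with hb
  have ham : MemLp a 2 volume := hu.inner_const _
  have hbm : MemLp b 2 volume := hφ.inner_const _
  have hau : lpNorm a 2 volume ≤ lpNorm u 2 volume := lpNorm_inner_const_le hu he1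
  have hbφ : lpNorm b 2 volume ≤ lpNorm φ 2 volume := lpNorm_inner_const_le hφ he1
  have hab : Integrable (fun x => a x * b x) volume := ham.integrable_mul hbm
  set D : RSpace d → ℝ := fun x => η (x + h) - η x with hD
  have hDc : Continuous D := by fun_prop
  have hDb : ∀ x, |D x| ≤ C * min 1 ‖h‖ := fun x => hη.incr x h
  have hI1 : Integrable (fun x => strainIncr h (fun x => η x • u x) x * strainIncr h φ x) volume :=
    (memLp_strainIncr (hη.memLp_smul hu) h).integrable_mul (memLp_strainIncr hφ h)
  have hI2 : Integrable (fun x => strainIncr h u x * strainIncr h (fun x => η x • φ x) x) volume :=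
    (memLp_strainIncr hu h).integrable_mul (memLp_strainIncr (hη.memLp_smul hφ) h)
  have hJ1 : Integrable (fun x => D x * (a (x + h) * b (x + h))) volume := by
    refine Integrable.bdd_mul (c := C * min 1 ‖h‖) ?_ hDc.aestronglyMeasurable
      (Filter.Eventually.of_forall hDb)
    exact (measurePreserving_add_const h).integrable_comp_of_integrable hab
  have hJ2 : Integrable (fun x => D x * (a x * b x)) volume :=
    hab.bdd_mul hDc.aestronglyMeasurable (Filter.Eventually.of_forall hDb)
  have hsum : MemLp (fun x => b (x + h) + b x) 2 volume := (memLp_shift hbm h).add hbm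
  have hDu : MemLp (fun x => D x • strainIncr h u x) 2 volume :=
    memLp_bounded_mul hDc hDb (memLp_strainIncr hu h)
  have hJ3 : Integrable (fun x => D x • strainIncr h u x * (b (x + h) + b x)) volume :=
    hDu.integrable_mul hsum
  have hpt : ∀ x, strainIncr h (fun x => η x • u x) x * strainIncr h φ x -
      strainIncr h u x * strainIncr h (fun x => η x • φ x) x =
      (D x * (a (x + h) * b (x + h)) - D x * (a x * b x)) -
        D x • strainIncr h u x * (b (x + h) + b x) := by
    intro x
    rw [strainIncr_smul, strainIncr_smul, strainIncr_eq, strainIncr_eq, smul_eq_mul]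
    simp only [hD, ha, hb]
    ring
  rw [← integral_sub hI1 hI2]
  simp only [hpt]
  have hJ12 : Integrable (fun x => D x * (a (x + h) * b (x + h)) - D x * (a x * b x)) volume :=
    hJ1.sub hJ2
  rw [integral_sub hJ12 hJ3, integral_sub hJ1 hJ2]
  have hshift : ∫ x, D x * (a (x + h) * b (x + h)) = ∫ x, (η x - η (x - h)) * (a x * b x) := by
    rw [← integral_add_right_eq_self (fun x => (η x - η (x - h)) * (a x * b x)) h]
    simp only [add_sub_cancel_right, hD]
  have hJ4 : Integrable (fun x => (η x - η (x - h)) * (a x * b x)) volume := by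
    refine hab.bdd_mul (c := C * min 1 ‖h‖) (by fun_prop) (Filter.Eventually.of_forall fun x => ?_)
    have := hη.incr (x - h) h
    rwa [sub_add_cancel] at this
  have hfirst : (∫ x, D x * (a (x + h) * b (x + h))) - ∫ x, D x * (a x * b x) =
      ∫ x, ((2 * η x - η (x - h) - η (x + h)) • a x) * b x := by
    rw [hshift, ← integral_sub hJ4 hJ2]
    congr 1
    funext x
    simp only [hD, smul_eq_mul]
    ring
  have hb1 : |∫ x, ((2 * η x - η (x - h) - η (x + h)) • a x) * b x| ≤
      C * min 1 ‖h‖ ^ 2 * lpNorm u 2 volume * lpNorm φ 2 volume := by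
    have h1 := memLp_bounded_mul (q := fun x => 2 * η x - η (x - h) - η (x + h)) (by fun_prop)
      (fun x => hη.incr_two x h) ham
    have h2 := lpNorm_bounded_mul_le (q := fun x => 2 * η x - η (x - h) - η (x + h)) (by fun_prop)
      (fun x => hη.incr_two x h) ham
    refine (abs_integral_mul_le_lpNorm h1 hbm).trans ?_
    refine mul_le_mul (h2.trans ?_) hbφ lpNorm_nonneg ?_
    · exact mul_le_mul_of_nonneg_left hau (mul_nonneg hη.nonneg (by positivity))
    · exact mul_nonneg (mul_nonneg hη.nonneg (by positivity)) lpNorm_nonneg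
  have hb2 : |∫ x, D x • strainIncr h u x * (b (x + h) + b x)| ≤
      C * min 1 ‖h‖ * lpNorm (strainIncr h u) 2 volume * (2 * lpNorm φ 2 volume) := by
    refine (abs_integral_mul_le_lpNorm hDu hsum).trans ?_
    refine mul_le_mul (lpNorm_bounded_mul_le hDc hDb (memLp_strainIncr hu h)) ?_ lpNorm_nonneg ?_
    · refine (lpNorm_add_le (memLp_shift hbm h) (by norm_num)).trans ?_
      rw [lpNorm_shift hbm]
      linarith
    · exact mul_nonneg (mul_nonneg hη.nonneg (by positivity)) lpNorm_nonneg
  rw [hfirst]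
  refine (abs_sub _ _).trans ((add_le_add hb1 hb2).trans (le_of_eq ?_))
  ring

/-- Cauchy–Schwarz in h for the factors √K min(1, |h|) and √K ‖D_h u‖. -/
theorem integral_sqrt_energyDensity_le (hK : IsLevyDensity K)
    (hu : MemS (fun x y => K (x - y)) u) :
    Integrable (fun h => K h * (min 1 ‖h‖ * lpNorm (strainIncr h u) 2 volume)) volume ∧
    ∫ h, K h * (min 1 ‖h‖ * lpNorm (strainIncr h u) 2 volume) ≤
      Real.sqrt (∫ h, K h * min 1 ‖h‖ ^ 2) * Real.sqrt (∫ h, energyDensity K u h) := by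
  have hKm := hK.measurable
  have hen := hu.integrable_energyDensity hK
  have hen0 : ∀ h, 0 ≤ energyDensity K u h := fun h => mul_nonneg (hK.nonneg h) (sq_nonneg _)
  have hF2 : ∀ h, (Real.sqrt (K h) * min 1 ‖h‖) ^ 2 = K h * min 1 ‖h‖ ^ 2 := fun h => by
    rw [mul_pow, Real.sq_sqrt (hK.nonneg h)]
  have hG2 : ∀ h, Real.sqrt (energyDensity K u h) ^ 2 = energyDensity K u h := fun h =>
    Real.sq_sqrt (hen0 h)
  have hF : MemLp (fun h => Real.sqrt (K h) * min 1 ‖h‖) 2 volume := by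
    rw [memLp_two_iff_integrable_sq (Measurable.aestronglyMeasurable (by fun_prop))]
    simp only [hF2]
    exact hK.integrable_min
  have hG : MemLp (fun h => Real.sqrt (energyDensity K u h)) 2 volume := by
    rw [memLp_two_iff_integrable_sq (Real.continuous_sqrt.comp_aestronglyMeasurable hen.1)]
    simp only [hG2]
    exact hen
  have hFG : ∀ h, Real.sqrt (K h) * min 1 ‖h‖ * Real.sqrt (energyDensity K u h) =
      K h * (min 1 ‖h‖ * lpNorm (strainIncr h u) 2 volume) := by
    intro h
    rw [energyDensity, Real.sqrt_mul (hK.nonneg h), Real.sqrt_sq lpNorm_nonneg]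
    have := Real.mul_self_sqrt (hK.nonneg h)
    linear_combination (min 1 ‖h‖ * lpNorm (strainIncr h u) 2 volume) * this
  have h1 := hF.integrable_mul hG
  have h2 := (le_abs_self _).trans (abs_integral_mul_le_lpNorm hF hG)
  have e1 := lpNorm_two_sq hF
  have e2 := lpNorm_two_sq hG
  simp only [Real.norm_eq_abs, sq_abs, hF2, hG2] at e1 e2
  rw [← e1, ← e2, Real.sqrt_sq lpNorm_nonneg, Real.sqrt_sq lpNorm_nonneg]
  simp only [hFG] at h2
  refine ⟨h1.congr (Filter.Eventually.of_forall hFG), h2⟩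

theorem HasIncrBound.abs_nonlocalForm_smul_sub_le (hK : IsLevyDensity K) (hη : HasIncrBound η C)
    (hu : MemS (fun x y => K (x - y)) u) (hφ : MemS (fun x y => K (x - y)) φ) :
    |nonlocalForm (fun x y => K (x - y)) (fun x => η x • u x) φ -
      nonlocalForm (fun x y => K (x - y)) u fun x => η x • φ x| ≤
    C * lpNorm φ 2 volume * ((∫ h, K h * min 1 ‖h‖ ^ 2) * lpNorm u 2 volume +
      Real.sqrt (∫ h, K h * min 1 ‖h‖ ^ 2) * Real.sqrt (∫ h, energyDensity K u h)) := by
  obtain ⟨i1, e1⟩ := nonlocalForm_eq_integral_strainIncr hK (hη.memS_smul hK hu) hφ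
  obtain ⟨i2, e2⟩ := nonlocalForm_eq_integral_strainIncr hK hu (hη.memS_smul hK hφ)
  obtain ⟨i3, h3⟩ := integral_sqrt_energyDensity_le hK hu
  have hκ : 0 ≤ ∫ h, K h * min 1 ‖h‖ ^ 2 :=
    integral_nonneg fun h => mul_nonneg (hK.nonneg h) (sq_nonneg _)
  have hCφ : 0 ≤ C * lpNorm φ 2 volume := mul_nonneg hη.nonneg lpNorm_nonneg
  rw [e1, e2, ← mul_sub, ← integral_sub i1 i2, abs_mul, abs_of_pos (by norm_num : (0 : ℝ) < 1 / 2)]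
  have hi : Integrable (fun h => (C * lpNorm φ 2 volume) * (lpNorm u 2 volume *
      (K h * min 1 ‖h‖ ^ 2) + 2 * (K h * (min 1 ‖h‖ * lpNorm (strainIncr h u) 2 volume)))) volume :=
    ((hK.integrable_min.const_mul _).add (i3.const_mul _)).const_mul _
  have h4 := norm_integral_le_of_norm_le (f := fun h =>
    (K h * ∫ y, strainIncr h (fun x => η x • u x) y * strainIncr h φ y) -
      K h * ∫ y, strainIncr h u y * strainIncr h (fun x => η x • φ x) y) hi
    (Filter.Eventually.of_forall fun h => ?_)
  · rw [integral_const_mul, integral_add (hK.integrable_min.const_mul _) (i3.const_mul _),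
      integral_const_mul, integral_const_mul] at h4
    rw [Real.norm_eq_abs] at h4
    refine (mul_le_mul_of_nonneg_left h4 (by norm_num)).trans ?_
    rw [mul_left_comm]
    refine mul_le_mul_of_nonneg_left ?_ hCφ
    have := mul_nonneg hκ (lpNorm_nonneg (f := u) (p := 2) (μ := volume))
    linarith
  · rw [← mul_sub, norm_mul, Real.norm_of_nonneg (hK.nonneg h)]
    refine (mul_le_mul_of_nonneg_left (hη.commutator_le hu.1 hφ.1 h) (hK.nonneg h)).trans
      (le_of_eq ?_)
    ring

end

/-! ### Interior regularity -/

/-- The Fourier multiplier `|ξ|^σ`, truncated to `|ξ| < R`. -/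
def truncPow (σ R : ℝ) (ξ : RSpace d) : ℝ := (Metric.ball 0 R).indicator (fun ξ => ‖ξ‖ ^ σ) ξ

theorem measurable_truncPow (σ R : ℝ) : Measurable (truncPow (d := d) σ R) :=
  Measurable.indicator (by fun_prop) measurableSet_ball

theorem truncPow_of_lt (σ : ℝ) {R : ℝ} {ξ : RSpace d} (h : ‖ξ‖ < R) :
    truncPow σ R ξ = ‖ξ‖ ^ σ := Set.indicator_of_mem (mem_ball_zero_iff.2 h) _

theorem truncPow_of_le (σ : ℝ) {R : ℝ} {ξ : RSpace d} (h : R ≤ ‖ξ‖) : truncPow σ R ξ = 0 :=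
  Set.indicator_of_notMem (fun h' => absurd (mem_ball_zero_iff.1 h') h.not_gt) _

theorem truncPow_nonneg (σ R : ℝ) (ξ : RSpace d) : 0 ≤ truncPow σ R ξ :=
  Set.indicator_nonneg (fun _ _ => by positivity) _

theorem truncPow_le {σ R : ℝ} (hσ : 0 ≤ σ) (hR : 0 ≤ R) (ξ : RSpace d) :
    truncPow σ R ξ ≤ R ^ σ := by
  by_cases h : ‖ξ‖ < R
  · rw [truncPow_of_lt σ h]
    exact Real.rpow_le_rpow (norm_nonneg _) h.le hσ
  · rw [truncPow_of_le σ (not_lt.1 h)]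
    positivity

theorem truncPow_mul_rpow (σ R : ℝ) (ξ : RSpace d) :
    truncPow σ R ξ * ‖ξ‖ ^ σ = truncPow σ R ξ ^ 2 := by
  by_cases h : ‖ξ‖ < R
  · rw [truncPow_of_lt σ h, sq]
  · rw [truncPow_of_le σ (not_lt.1 h)]
    simp

theorem norm_complexL2 {w : RSpace d → RSpace d} (hw : MemLp w 2 volume) :
    ‖complexL2 w hw‖ = lpNorm w 2 volume := by
  rw [complexL2, Lp.norm_toLp, ← toReal_eLpNorm hw.1]
  congr 1
  exact eLpNorm_congr_norm_ae (Filter.Eventually.of_forall fun x => norm_toComplexVec _)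

/-- The field φ is the real part of the inverse transform Φ of g ŵ, with g the truncated power, and
X = ‖Φ‖. Truncation gives φ finite energy. The form at (w, φ) controls frequencies |ξ| ≥ 1, and ‖w‖
controls the rest. -/
theorem exists_test_field (hK : IsLevyDensity K) {s : ℝ} (hs0 : 0 < s) {t₀ : RSpace d}
    {δ α : ℝ} (hE : IsConeElliptic K s t₀ δ α) :
    ∃ c : ℝ, 0 < c ∧ ∀ (w : RSpace d → RSpace d) (hw : MemS (fun x y => K (x - y)) w) (R : ℝ),
      1 ≤ R → ∃ (φ : RSpace d → RSpace d) (X : ℝ), MemS (fun x y => K (x - y)) φ ∧ 0 ≤ X ∧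
        lpNorm φ 2 volume ≤ X ∧
        X ^ 2 ≤ lpNorm w 2 volume ^ 2 + c * nonlocalForm (fun x y => K (x - y)) w φ ∧
        eLpNorm (fun ξ => truncPow (2 * s) R ξ •
          (𝓕 (complexL2 w hw.1) : Lp (CSpace d) 2 (volume : Measure (RSpace d))) ξ) 2 volume =
            ENNReal.ofReal X := by
  obtain ⟨c, hc0, hc⟩ := exists_le_lintegral_symbol hK hE
  refine ⟨2 / c, by positivity, fun w hw R hR => ?_⟩
  set g : RSpace d → ℝ := truncPow (2 * s) R with hg
  set V : Lp (CSpace d) 2 (volume : Measure (RSpace d)) := 𝓕 (complexL2 w hw.1) with hV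
  have hgm : Measurable g := measurable_truncPow _ _
  have hg0 : ∀ ξ, 0 ≤ g ξ := truncPow_nonneg _ _
  have hΨ : MemLp (fun ξ => g ξ • V ξ) 2 volume := by
    refine (Lp.memLp V).of_le_mul (c := R ^ (2 * s))
      (hgm.aestronglyMeasurable.smul (Lp.memLp V).1) (Filter.Eventually.of_forall fun ξ => ?_)
    rw [norm_smul, Real.norm_of_nonneg (hg0 ξ)]
    gcongr
    exact truncPow_le (by positivity) (by positivity) ξ
  set Φ : Lp (CSpace d) 2 (volume : Measure (RSpace d)) := 𝓕⁻ (hΨ.toLp _) with hΦ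
  have hFΦ : 𝓕 Φ = hΨ.toLp _ := FourierTransform.fourier_fourierInv_eq _
  have hFae : (𝓕 Φ : Lp (CSpace d) 2 (volume : Measure (RSpace d))) =ᵐ[volume]
      fun ξ => g ξ • V ξ := by
    rw [hFΦ]
    exact hΨ.coeFn_toLp
  have hnorm : ‖Φ‖ = lpNorm (fun ξ => g ξ • V ξ) 2 volume := by
    rw [← Lp.norm_fourier_eq Φ, hFΦ, Lp.norm_toLp, toReal_eLpNorm hΨ.1]
  have hΦS : MemS (fun x y => K (x - y)) fun x => reVec (Φ x) := by
    refine memS_reVec hK hR ?_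
    filter_upwards [hFae] with ξ h1 h2
    rw [h1, hg, truncPow_of_le _ h2, zero_smul]
  refine ⟨fun x => reVec (Φ x), ‖Φ‖, hΦS, norm_nonneg _, lpNorm_reVec_le Φ, ?_, ?_⟩
  swap
  · rw [hnorm, ofReal_lpNorm hΨ]
  set Q : RSpace d → RSpace d → ℝ := fun h ξ => ‖incrSymbol h ξ * dirComponent h (V ξ)‖ ^ 2 with hQ
  have hFae' : (𝓕 Φ : Lp (CSpace d) 2 (volume : Measure (RSpace d))) =ᵐ[volume]
      fun ξ => (g ξ : ℂ) • V ξ := by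
    filter_upwards [hFae] with ξ h1
    rw [h1, ← Complex.coe_smul]
  have hJ := fun h => integral_strainIncr_mul_reVec hw.1 hFae' h
  obtain ⟨i1, e1⟩ := nonlocalForm_eq_integral_strainIncr hK hw hΦS
  have e2 : ∀ h, K h * ∫ y, strainIncr h w y * strainIncr h (fun x => reVec (Φ x)) y =
      ∫ ξ, K h * (g ξ * Q h ξ) := by
    intro h
    rw [(hJ h).2, integral_const_mul]
  simp only [e2] at i1 e1
  have hnn : ∀ h ξ, 0 ≤ K h * (g ξ * Q h ξ) := fun h ξ =>
    mul_nonneg (hK.nonneg h) (mul_nonneg (hg0 ξ) (sq_nonneg _))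
  have hQm : Measurable fun p : RSpace d × RSpace d => Q p.1 p.2 := by
    have h1 : Measurable fun p : RSpace d × RSpace d => toComplexVec (‖p.1‖⁻¹ • p.1) :=
      continuous_toComplexVec.measurable.comp (by fun_prop)
    have h2 : Measurable fun p : RSpace d × RSpace d => V p.2 :=
      (Lp.stronglyMeasurable V).measurable.comp measurable_snd
    exact (continuous_incrSymbol.measurable.mul (h1.inner h2)).norm.pow_const 2
  -- All integrands are nonnegative, so Tonelli exchanges h and ξ and exposes the symbol of the
  -- form.
  have hform : ENNReal.ofReal (2 * nonlocalForm (fun x y => K (x - y)) w fun x => reVec (Φ x)) =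
      ∫⁻ ξ, ENNReal.ofReal (g ξ) * ∫⁻ h, ENNReal.ofReal (K h * Q h ξ) := by
    rw [e1, ← mul_assoc, mul_one_div_cancel two_ne_zero, one_mul,
      ofReal_integral_eq_lintegral_ofReal i1
        (Filter.Eventually.of_forall fun h => integral_nonneg (hnn h))]
    have e3 : ∀ h, ENNReal.ofReal (∫ ξ, K h * (g ξ * Q h ξ)) =
        ∫⁻ ξ, ENNReal.ofReal (K h * (g ξ * Q h ξ)) := fun h =>
      ofReal_integral_eq_lintegral_ofReal ((hJ h).1.const_mul _)
        (Filter.Eventually.of_forall (hnn h))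
    simp only [e3]
    rw [lintegral_lintegral_swap]
    · refine lintegral_congr fun ξ => ?_
      rw [← lintegral_const_mul' _ _ ENNReal.ofReal_ne_top]
      refine lintegral_congr fun h => ?_
      rw [← ENNReal.ofReal_mul (hg0 ξ)]
      congr 1
      ring
    · exact ((hK.measurable.comp measurable_fst).mul
        ((hgm.comp measurable_snd).mul hQm)).ennreal_ofReal.aemeasurable
  -- On the unit ball g ≤ 1; outside it the symbol bound applies, and g |ξ|^(2s) = g² turns it into
  -- |g ŵ|².
  set A : Set (RSpace d) := Metric.ball 0 1 with hA
  have hAm : MeasurableSet A := measurableSet_ball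
  have hΨ2 : Integrable (fun ξ => ‖g ξ • V ξ‖ ^ 2) volume :=
    (memLp_two_iff_integrable_sq_norm hΨ.1).1 hΨ
  have hV2 : Integrable (fun ξ => ‖V ξ‖ ^ 2) volume :=
    (memLp_two_iff_integrable_sq_norm (Lp.memLp V).1).1 (Lp.memLp V)
  have hlow : ∫ ξ in A, ‖g ξ • V ξ‖ ^ 2 ≤ lpNorm w 2 volume ^ 2 := by
    have h1 : ∫ ξ in A, ‖g ξ • V ξ‖ ^ 2 ≤ ∫ ξ in A, ‖V ξ‖ ^ 2 := by
      refine setIntegral_mono_on hΨ2.integrableOn hV2.integrableOn hAm fun ξ hξ => ?_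
      have hξ1 : ‖ξ‖ < 1 := mem_ball_zero_iff.1 hξ
      rw [norm_smul, Real.norm_of_nonneg (hg0 ξ)]
      refine pow_le_pow_left₀ (mul_nonneg (hg0 ξ) (norm_nonneg _)) ?_ 2
      refine mul_le_of_le_one_left (norm_nonneg _) ?_
      rw [hg, truncPow_of_lt _ (hξ1.trans_le hR)]
      exact Real.rpow_le_one (norm_nonneg _) hξ1.le (by positivity)
    have h2 : ∫ ξ in A, ‖V ξ‖ ^ 2 ≤ ∫ ξ, ‖V ξ‖ ^ 2 :=
      setIntegral_le_integral hV2 (Filter.Eventually.of_forall fun ξ => sq_nonneg _)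
    have h3 : ∫ ξ, ‖V ξ‖ ^ 2 = lpNorm w 2 volume ^ 2 := by
      rw [← lpNorm_two_sq (Lp.memLp V), ← toReal_eLpNorm (Lp.memLp V).1, ← Lp.norm_def, hV,
        Lp.norm_fourier_eq, norm_complexL2]
    exact (h1.trans h2).trans h3.le
  have hform0 : 0 ≤ nonlocalForm (fun x y => K (x - y)) w fun x => reVec (Φ x) := by
    rw [e1]
    exact mul_nonneg (by norm_num) (integral_nonneg fun h => integral_nonneg (hnn h))
  have hhigh : ∫ ξ in Aᶜ, c * ‖g ξ • V ξ‖ ^ 2 ≤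
      2 * nonlocalForm (fun x y => K (x - y)) w fun x => reVec (Φ x) := by
    rw [← ENNReal.ofReal_le_ofReal_iff (by positivity), hform,
      ofReal_integral_eq_lintegral_ofReal (hΨ2.const_mul c).integrableOn
        (Filter.Eventually.of_forall fun ξ => by positivity)]
    refine le_trans (setLIntegral_mono' hAm.compl fun ξ hξ => ?_) (setLIntegral_le_lintegral Aᶜ _)
    have hξ1 : 1 ≤ ‖ξ‖ := by
      have : ¬ ‖ξ‖ < 1 := fun h => hξ (mem_ball_zero_iff.2 h)
      exact not_lt.1 this
    refine le_trans (le_of_eq ?_) (mul_le_mul_right (hc ξ (V ξ) hξ1) _)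
    rw [← ENNReal.ofReal_mul (hg0 ξ), norm_smul, Real.norm_of_nonneg (hg0 ξ), mul_pow,
      ← truncPow_mul_rpow]
    congr 1
    ring
  have hsplit : ‖Φ‖ ^ 2 = (∫ ξ in A, ‖g ξ • V ξ‖ ^ 2) + ∫ ξ in Aᶜ, ‖g ξ • V ξ‖ ^ 2 := by
    rw [hnorm, lpNorm_two_sq hΨ, integral_add_compl hAm hΨ2]
  rw [integral_const_mul] at hhigh
  rw [hsplit]
  refine add_le_add hlow ?_
  rw [div_mul_eq_mul_div, le_div_iff₀ hc0]
  linarith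

section

variable {Ω : Set (RSpace d)} {f u : RSpace d → RSpace d} {C : ℝ}

/-- Testing with u itself gives ½ N² = ∫ f · u ≤ ‖f‖ C N for the norm N of the strain. -/
theorem IsWeakSolution.lpNorm_weightedStrain_le (hK : IsLevyDensity K)
    (hP : HasPoincare (fun x y => K (x - y)) Ω C) (hf : MemLp f 2 volume)
    (hu : IsWeakSolution (fun x y => K (x - y)) Ω f u) :
    lpNorm (weightedStrain (fun x y => K (x - y)) u) 2 volume ≤ 2 * C * lpNorm f 2 volume := by
  set N := lpNorm (weightedStrain (fun x y => K (x - y)) u) 2 volume with hN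
  have h1 := hu.2 u hu.1
  rw [nonlocalForm_self_eq hK hu.1.1, ← lpNorm_weightedStrain_sq hK hu.1.1] at h1
  have h2 := (le_abs_self _).trans (norm_integral_inner_le_lpNorm (𝕜 := ℝ) hf hu.1.memLp)
  rw [← h1] at h2
  have h3 := hP.2 u hu.1
  have h4 : lpNorm f 2 volume * lpNorm u 2 volume ≤ lpNorm f 2 volume * (C * N) :=
    mul_le_mul_of_nonneg_left h3 lpNorm_nonneg
  have hN0 : 0 ≤ N := lpNorm_nonneg
  have hf0 : 0 ≤ lpNorm f 2 volume := lpNorm_nonneg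
  have hC := hP.1
  rcases hN0.eq_or_lt with h5 | h5
  · rw [← h5]
    positivity
  · refine le_of_mul_le_mul_right ?_ h5
    nlinarith

theorem IsWeakSolution.lpNorm_le (hK : IsLevyDensity K)
    (hP : HasPoincare (fun x y => K (x - y)) Ω C) (hf : MemLp f 2 volume)
    (hu : IsWeakSolution (fun x y => K (x - y)) Ω f u) :
    lpNorm u 2 volume ≤ 2 * C ^ 2 * lpNorm f 2 volume := by
  have h1 := hP.2 u hu.1
  have h2 := mul_le_mul_of_nonneg_left (hu.lpNorm_weightedStrain_le hK hP hf) hP.1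
  linarith

theorem memSVanishing_cutoff_smul (hK : IsLevyDensity K) {η : RSpace d → ℝ} (hη : IsCutoff Ω η)
    {B : ℝ} (hB : HasIncrBound η B) {φ : RSpace d → RSpace d}
    (hφ : MemS (fun x y => K (x - y)) φ) :
    MemSVanishing (fun x y => K (x - y)) Ω fun x => η x • φ x := by
  refine ⟨hB.memS_smul hK hφ, Filter.Eventually.of_forall fun x hx => ?_⟩
  beta_reduce
  rw [image_eq_zero_of_notMem_tsupport fun h => hx (hη.2.2 h), zero_smul]

/-- Although φ need not vanish outside Ω, ηφ does and is an admissible test field. The equation and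
the commutator bound then combine with the a priori bounds on u. -/
theorem exists_abs_nonlocalForm_cutoff_smul_le (hK : IsLevyDensity K)
    (hP : HasPoincare (fun x y => K (x - y)) Ω C) {η : RSpace d → ℝ} (hη : IsCutoff Ω η)
    {B : ℝ} (hB : HasIncrBound η B) :
    ∃ A : ℝ, 0 ≤ A ∧ ∀ f u φ : RSpace d → RSpace d, MemLp f 2 volume →
      IsWeakSolution (fun x y => K (x - y)) Ω f u → MemS (fun x y => K (x - y)) φ →
      nonlocalForm (fun x y => K (x - y)) (fun x => η x • u x) φ ≤
        A * lpNorm f 2 volume * lpNorm φ 2 volume := by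
  set κ := ∫ h, K h * min 1 ‖h‖ ^ 2 with hκ
  have hκ0 : 0 ≤ κ := integral_nonneg fun h => mul_nonneg (hK.nonneg h) (sq_nonneg _)
  have hC := hP.1
  have hB0 := hB.nonneg
  refine ⟨B * (κ * (2 * C ^ 2) + Real.sqrt κ * (2 * C) + 1), by positivity,
    fun f u φ hf hu hφ => ?_⟩
  have h1 := (le_abs_self _).trans (hB.abs_nonlocalForm_smul_sub_le hK hu.1.1 hφ)
  rw [hu.2 _ (memSVanishing_cutoff_smul hK hη hB hφ), ← lpNorm_weightedStrain_sq hK hu.1.1,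
    Real.sqrt_sq lpNorm_nonneg] at h1
  have h2 := (le_abs_self _).trans
    (norm_integral_inner_le_lpNorm (𝕜 := ℝ) hf (hB.memLp_smul hφ.1))
  have h3 := mul_le_mul_of_nonneg_left (hB.lpNorm_smul_le hφ.1)
    (lpNorm_nonneg (f := f) (p := 2) (μ := volume))
  have h4 := hu.lpNorm_le hK hP hf
  have h5 := hu.lpNorm_weightedStrain_le hK hP hf
  have h6 : κ * lpNorm u 2 volume + Real.sqrt κ *
      lpNorm (weightedStrain (fun x y => K (x - y)) u) 2 volume ≤
      κ * (2 * C ^ 2 * lpNorm f 2 volume) + Real.sqrt κ * (2 * C * lpNorm f 2 volume) := by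
    gcongr
  have h7 := mul_le_mul_of_nonneg_left h6
    (mul_nonneg hB0 (lpNorm_nonneg (f := φ) (p := 2) (μ := volume)))
  have h8 := h1.trans h7
  linarith

theorem exists_hsSeminorm_cutoff_smul_le (hK : IsLevyDensity K) {s : ℝ} (hs0 : 0 < s)
    {t₀ : RSpace d} {δ α : ℝ} (hE : IsConeElliptic K s t₀ δ α)
    (hP : HasPoincare (fun x y => K (x - y)) Ω C) {η : RSpace d → ℝ} (hη : IsCutoff Ω η) :
    ∃ A : ℝ, 0 < A ∧ ∀ f u : RSpace d → RSpace d, MemLp f 2 volume →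
      IsWeakSolution (fun x y => K (x - y)) Ω f u →
        hsSeminorm (2 * s) (fun x => η x • u x) ≤ ENNReal.ofReal A * eLpNorm f 2 volume := by
  obtain ⟨B, hB⟩ := exists_hasIncrBound hη.1 hη.2.1
  obtain ⟨c, hc0, hc⟩ := exists_test_field hK hs0 hE
  obtain ⟨A, hA0, hA⟩ := exists_abs_nonlocalForm_cutoff_smul_le hK hP hη hB
  have hB0 := hB.nonneg
  -- The summand 1 only ensures positivity.
  refine ⟨B * (2 * C ^ 2) + c * A + 1, by positivity, fun f u hf hu => ?_⟩
  have hw : MemS (fun x y => K (x - y)) fun x => η x • u x := hB.memS_smul hK hu.1.1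
  have hF0 : 0 ≤ lpNorm f 2 volume := lpNorm_nonneg
  rw [hsSeminorm, dif_pos hw.1, ← ofReal_lpNorm hf, ← ENNReal.ofReal_mul (by positivity)]
  set V : Lp (CSpace d) 2 (volume : Measure (RSpace d)) := 𝓕 (complexL2 _ hw.1) with hV
  have hbound : ∀ n : ℕ, eLpNorm (fun ξ => truncPow (2 * s) (n + 1) ξ • V ξ) 2 volume ≤
      ENNReal.ofReal ((B * (2 * C ^ 2) + c * A + 1) * lpNorm f 2 volume) := by
    intro n
    obtain ⟨φ, X, hφ, hX0, hφX, hX, hXe⟩ := hc _ hw (n + 1) (by linarith [n.cast_nonneg (α := ℝ)])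
    rw [hXe]
    refine ENNReal.ofReal_le_ofReal ?_
    have h1 := hA f u φ hf hu hφ
    have h2 : A * lpNorm f 2 volume * lpNorm φ 2 volume ≤ A * lpNorm f 2 volume * X := by gcongr
    have h3 : lpNorm (fun x => η x • u x) 2 volume ≤ B * (2 * C ^ 2) * lpNorm f 2 volume := by
      have := mul_le_mul_of_nonneg_left (hu.lpNorm_le hK hP hf) hB0
      exact (hB.lpNorm_smul_le hu.1.memLp).trans (this.trans (le_of_eq (by ring)))
    have h4 := pow_le_pow_left₀ lpNorm_nonneg h3 2
    have h5 := mul_le_mul_of_nonneg_left (h1.trans h2) hc0.le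
    set a := B * (2 * C ^ 2) * lpNorm f 2 volume with ha
    set b := c * A * lpNorm f 2 volume with hb
    have ha0 : 0 ≤ a := by positivity
    have hb0 : 0 ≤ b := by positivity
    have h6 : X ^ 2 ≤ a ^ 2 + b * X := by
      have : c * (A * lpNorm f 2 volume * X) = b * X := by rw [hb]; ring
      linarith
    -- If X > a + b, then X² > (a + b) X ≥ a² + b X.
    have h7 : X ≤ a + b := by
      by_contra! h
      nlinarith
    have h8 : (B * (2 * C ^ 2) + c * A + 1) * lpNorm f 2 volume = a + b + lpNorm f 2 volume := by
      rw [ha, hb]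
      ring
    linarith
  have hlim : ∀ᵐ ξ ∂(volume : Measure (RSpace d)), Filter.Tendsto
      (fun n : ℕ => truncPow (2 * s) (n + 1) ξ • V ξ) Filter.atTop (nhds (‖ξ‖ ^ (2 * s) • V ξ)) := by
    refine Filter.Eventually.of_forall fun ξ => tendsto_const_nhds.congr' ?_
    obtain ⟨N, hN⟩ := exists_nat_gt ‖ξ‖
    filter_upwards [Filter.eventually_ge_atTop N] with n hn
    rw [truncPow_of_lt]
    have : (N : ℝ) ≤ n := by exact_mod_cast hn
    linarith
  -- Fatou's lemma: the bound is uniform in the truncation n + 1.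
  refine (Lp.eLpNorm_lim_le_liminf_eLpNorm (fun n => ?_) _ hlim).trans ?_
  · exact (measurable_truncPow _ _).aestronglyMeasurable.smul (Lp.memLp V).1
  · exact (Filter.liminf_le_liminf (Filter.Eventually.of_forall hbound)).trans
      (Filter.liminf_const _).le

/-- The weight (1 + |ξ|²)^(σ/2) is at most 2^(σ/2) (1 + |ξ|^σ), so square integrability of û and of
|ξ|^σ û suffices. -/
theorem memHs_of_hsSeminorm_lt_top {σ : ℝ} (hσ : 0 ≤ σ) (hu : hsSeminorm σ u < ⊤) :
    MemHs σ u := by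
  by_cases hu2 : MemLp u 2 volume
  swap
  · rw [hsSeminorm, dif_neg hu2] at hu
    exact absurd rfl hu.ne
  refine ⟨hu2, ?_⟩
  rw [hsSeminorm, dif_pos hu2] at hu
  rw [TemperedDistribution.memSobolev_iff_exists_smulLeftCLM_fourier,
    Lp.fourier_toTemperedDistribution_eq]
  set V : Lp (CSpace d) 2 (volume : Measure (RSpace d)) := 𝓕 (complexL2 u hu2) with hV
  have hm : MemLp (fun ξ : RSpace d => ‖ξ‖ ^ σ • V ξ) 2 volume :=
    ⟨((measurable_norm (α := RSpace d)).pow_const σ).aestronglyMeasurable.smul (Lp.memLp V).1, hu⟩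
  have hg : MemLp (fun ξ : RSpace d => (((1 + ‖ξ‖ ^ 2) ^ (σ / 2) : ℝ) : ℂ) • V ξ) 2 volume := by
    have h1 : MemLp (fun ξ : RSpace d => ‖V ξ‖ + ‖‖ξ‖ ^ σ • V ξ‖) 2 volume :=
      (Lp.memLp V).norm.add hm.norm
    have h0 : Measurable fun ξ : RSpace d => (((1 + ‖ξ‖ ^ 2) ^ (σ / 2) : ℝ) : ℂ) := by fun_prop
    refine h1.of_le_mul (c := 2 ^ (σ / 2)) (h0.aestronglyMeasurable.smul (Lp.memLp V).1)
      (Filter.Eventually.of_forall fun ξ => ?_)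
    · rw [norm_smul, Complex.norm_real, Real.norm_of_nonneg (by positivity),
        Real.norm_of_nonneg (by positivity), norm_smul, Real.norm_of_nonneg (by positivity)]
      have h2 : (1 + ‖ξ‖ ^ 2) ^ (σ / 2) ≤ 2 ^ (σ / 2) * (1 + ‖ξ‖ ^ σ) := by
        rcases le_total ‖ξ‖ 1 with h3 | h3
        · have h4 : (1 + ‖ξ‖ ^ 2) ^ (σ / 2) ≤ 2 ^ (σ / 2) :=
            Real.rpow_le_rpow (by positivity) (by nlinarith [norm_nonneg ξ]) (by positivity)
          have h5 : 0 ≤ ‖ξ‖ ^ σ := by positivity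
          have h6 : (0 : ℝ) ≤ 2 ^ (σ / 2) := by positivity
          nlinarith
        · have h4 : (1 + ‖ξ‖ ^ 2) ^ (σ / 2) ≤ (2 * ‖ξ‖ ^ 2) ^ (σ / 2) :=
            Real.rpow_le_rpow (by positivity) (by nlinarith [norm_nonneg ξ]) (by positivity)
          have h5 : (2 * ‖ξ‖ ^ 2) ^ (σ / 2) = 2 ^ (σ / 2) * ‖ξ‖ ^ σ := by
            rw [Real.mul_rpow (by norm_num) (by positivity), ← Real.rpow_natCast ‖ξ‖ 2,
              ← Real.rpow_mul (norm_nonneg _)]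
            congr 2
            push_cast
            ring
          have h6 : (0 : ℝ) ≤ 2 ^ (σ / 2) := by positivity
          rw [h5] at h4
          nlinarith
      calc (1 + ‖ξ‖ ^ 2) ^ (σ / 2) * ‖V ξ‖ ≤ 2 ^ (σ / 2) * (1 + ‖ξ‖ ^ σ) * ‖V ξ‖ := by gcongr
        _ = _ := by ring
  refine ⟨hg.toLp _, ?_⟩
  have hgrowth : (fun ξ : RSpace d =>
      (((1 + ‖ξ‖ ^ 2) ^ (σ / 2) : ℝ) : ℂ)).HasTemperateGrowth := by fun_prop
  ext1 ψ
  simp only [Lp.toTemperedDistribution_apply, TemperedDistribution.smulLeftCLM_apply_apply]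
  refine integral_congr_ae ?_
  filter_upwards [hg.coeFn_toLp] with ξ h1
  rw [h1, SchwartzMap.smulLeftCLM_apply_apply hgrowth, smul_smul, smul_eq_mul, mul_comm]

end

end

/-! ### The theorem for cone kernels -/

theorem mainTheorem2 (d : ℕ) (s : ℝ) (hs0 : 0 < s) (hs1 : s < 1)
    (m : RSpace d → ℝ) (hm_meas : Measurable m) (hm_even : ∀ z, m (-z) = m z)
    (α₁ α₂ : ℝ) (hα₁ : 0 < α₁) (hm_bdd : ∀ z, α₁ ≤ m z ∧ m z ≤ α₂)
    (Λ : Set (RSpace d)) (hΛ : IsDoubleCone Λ) (r : ℝ≥0∞) (hr : 0 < r)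
    (Ω : Set (RSpace d)) (hΩ_open : IsOpen Ω) (hΩ_bdd : Bornology.IsBounded Ω) :
    -- existence and (a.e.) uniqueness of the weak solution
    (∀ f : RSpace d → RSpace d, MemL2Vanishing Ω f →
      ∃ u : RSpace d → RSpace d, IsWeakSolution (coneKernel s m Λ r) Ω f u ∧
        ∀ v : RSpace d → RSpace d, IsWeakSolution (coneKernel s m Λ r) Ω f v →
          v =ᵐ[volume] u) ∧
    -- interior regularity
    (∀ f u : RSpace d → RSpace d, MemL2Vanishing Ω f →
      IsWeakSolution (coneKernel s m Λ r) Ω f u → MemHsLoc (2 * s) Ω u) ∧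
    -- interior estimate, with a constant independent of `f` and `u`
    (∀ η : RSpace d → ℝ, IsCutoff Ω η →
      ∃ C : ℝ, 0 < C ∧ ∀ f u : RSpace d → RSpace d, MemL2Vanishing Ω f →
        IsWeakSolution (coneKernel s m Λ r) Ω f u →
          hsSeminorm (2 * s) (fun x => η x • u x) ≤ ENNReal.ofReal C * eLpNorm f 2 volume) := by
  obtain ⟨I, hI, hne, rfl⟩ := hΛ
  -- In dimension zero the unit sphere is empty and has no nonempty set of directions.
  have hd : 0 < d := by
    obtain ⟨e, -⟩ := hne
    rcases Nat.eq_zero_or_pos d with rfl | h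
    · exact absurd (Subsingleton.elim (e : RSpace 0) 0)
        (ne_zero_of_mem_unit_sphere e)
    · exact h
  have hK := isLevyDensity_coneDensity hs0 hs1 hm_meas hm_even hα₁ hm_bdd hI hd r
  obtain ⟨t₀, δ, hE⟩ := exists_isConeElliptic_coneDensity hs0 hα₁ (fun z => (hm_bdd z).1) hI hne hr
  obtain ⟨C, hP⟩ := exists_hasPoincare hK hE hΩ_bdd
  have hF := formEqStrain_of_isLevyDensity hK
  simp only [coneKernel_eq]
  have hest : ∀ η : RSpace d → ℝ, IsCutoff Ω η → _ := fun η hη =>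
    exists_hsSeminorm_cutoff_smul_le hK hs0 hE hP hη
  refine ⟨fun f hf => ?_, fun f u hf hu => ⟨hu.1.memLp.restrict Ω, fun η hη => ?_⟩, fun η hη => ?_⟩
  · obtain ⟨u, hu⟩ := exists_isWeakSolution hP hF hf.1
    exact ⟨u, hu, fun v hv => hu.ae_eq hP hF hv⟩
  · obtain ⟨A, -, hA⟩ := hest η hη
    exact memHs_of_hsSeminorm_lt_top (by positivity) ((hA f u hf.1 hu).trans_lt
      (ENNReal.mul_lt_top ENNReal.ofReal_lt_top hf.1.2))
  · obtain ⟨A, hA0, hA⟩ := hest η hη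
    exact ⟨A, hA0, fun f u hf hu => hA f u hf.1 hu⟩
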